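/- Let $k$ be a field. A $k$-variety is a separated $k$-scheme of finite type; $K_0(\mathrm{Var}_k)$ is the Grothendieck ring of $k$-varieties, $[V]$ is the class (motive) of $V$, and $\mathbb L=[\mathbb A^1_k]$. A locally closed subset of an affine space is regarded as a variety with its reduced structure. For $d\ge 0$ let $V_d\subseteq \mathrm{Mat}_d^2$ be the closed subvariety of pairs $(X,Y)$ of strictly upper triangular $d\times d$ matrices with $X^2=Y^3$ and $XY=YX$. For $(X,Y)\in V_d$ put $A_{X,Y}=\begin{pmatrix}X&-Y^2\\-Y&X\end{pmatrix}$, a $2d\times 2d$ matrix. For integers $a,b$ let $V_{(a,b)}$ be the locus in $V_d$, $d=(a+b)/2$, where $\dim\ker A_{X,Y}=a$ and $\dim\operatorname{im}A_{X,Y}=b$ (empty if $a+b$ is odd or negative). It is locally closed. **Theorem.** (1) The motives $[V_{(a,b)}]$ are computed inductively by $[V_{(0,0)}]=1$; $[V_{(a,b)}]=0$ unless $a\ge b\ge 0$ and $a\equiv b \pmod 2$; and, for all $(a,b)\ne(0,0)$ with $a\ge b\ge 0$ and $a\equiv b\pmod 2$, $$[V_{(a,b)}]=\mathbb L^b[V_{(a-2,b)}]+\bigl(\mathbb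 L^{\frac{a+b-2}{2}}-\mathbb L^{b-1}\bigr)[V_{(a-1,b-1)}]+\bigl(\mathbb L^a-\mathbb L^{\frac{a+b-2}{2}}\bigr)[V_{(a,b-2)}],$$ where the middle term is read as $0$ if $b=0$. Moreover $[V_d]=\sum_{b=0}^d[V_{(2d-b,b)}]$ for all $d\ge 0$. (2) Consequently there are polynomials $P_{a,b}\in\mathbb Z[t]$, independent of $k$ and given by the same recursion with $t$ in place of $\mathbb L$, such that $[V_{(a,b)}]=P_{a,b}(\mathbb L)$ and $[V_d]=P_d(\mathbb L)$, where $P_d=\sum_{b=0}^dP_{2d-b,b}$. (3) Let $J(a)=(T^{a+1})$ for $a\ge1$ and $K(a)=(T^{a+2},T^{a+3})$ for $a\ge0$ be the nonzero proper monomial ideals of $k[[T^2,T^3]]$; they have color $J$, $K$ and level $a-1$, $a$ respectively. Let $\alpha=(I_1,\dots,I_d)$ be a tuple of such ideals and let $l_i$ be the level of $I_i$. Order the monomials $T^nu_i$ of $k[[T]]^d$ first by $n$, then by $i$, and put $\mu_i^0=T^{l_i+2}u_i$. Let $i_{(1)},\dots,i_{(d)}$ be the permutation of the indices with $\mu^0_{i_{(1)}}\prec\dots\prec\mu^0_{i_{(d)}}$,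 and for $b<h$ put $\delta_{(bh)}=\bigl\lfloor l_{i_{(h)}}+\tfrac{i_{(h)}}d-l_{i_{(b)}}-\tfrac{i_{(b)}}d\bigr\rfloor$. The datum $\alpha$ is stable under $\gamma_{(j)}$ if for all $1\le b<j\le h\le d$: $\delta_{(bh)}\ge1$ whenever $I_{i_{(b)}}$ has color $J$, and $\delta_{(bh)}\ge 3$ whenever $I_{i_{(b)}}$ and $I_{i_{(h)}}$ both have color $K$. For $\alpha$ with all components of color $K$, let $V(\alpha)\subseteq\mathrm{Mat}_d^2$ be the closed subvariety of pairs $(X,Y)$ with $X^2=Y^3$, $XY=YX$, $X_{ij}=0$ if $\mu_j^0\prec T^3\mu_i^0$, and $Y_{ij}=0$ if $\mu_j^0\prec T^2\mu_i^0$. If all components of $\alpha$ have color $K$ and $\alpha$ is stable under $\gamma_{(j)}$ for every $1\le j\le d$, then $[V(\alpha)]=P_d(\mathbb L)$, the same polynomial in $\mathbb L$ for all such $\alpha$. -/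

import Mathlib

open CategoryTheory AlgebraicGeometry Polynomial

universe u

namespace CuspStaircase

/-! ### The Grothendieck ring of varieties -/

/-- A variety over `k`: a separated `k`-scheme of finite type (not necessarily smooth, proper,
reduced or irreducible). -/
structure Variety (k : Type u) [Field k] where
  /-- the underlying `k`-scheme -/
  obj : Over (Spec (CommRingCat.of k))
  locallyOfFiniteType : LocallyOfFiniteType obj.hom
  quasiCompact : QuasiCompact obj.hom
  isSeparated : IsSeparated obj.hom

/-- The defining relations of the Grothendieck ring of `k`-varieties. -/
inductive VarRelation (k : Type u) [Field k] : MvPolynomial (Variety k) ℤ → Prop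
  /-- isomorphic varieties have the same class -/
  | iso (V W : Variety k) (e : V.obj ≅ W.obj) :
      VarRelation k (MvPolynomial.X V - MvPolynomial.X W)
  /-- scissor relation: `[V] = [Z] + [U]` for `Z` closed in `V` with open complement `U` -/
  | scissor (V Z U : Variety k) (i : Z.obj ⟶ V.obj) (j : U.obj ⟶ V.obj)
      (hi : IsClosedImmersion i.left) (hj : IsOpenImmersion j.left)
      (hc : Set.range j.left = (Set.range i.left)ᶜ) :
      VarRelation k (MvPolynomial.X V - (MvPolynomial.X Z + MvPolynomial.X U))
  /-- `[V ×ₖ W] = [V] [W]` -/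
  | prod (V W P : Variety k) (p : P.obj ⟶ V.obj) (q : P.obj ⟶ W.obj)
      (h : IsPullback p.left q.left V.obj.hom W.obj.hom) :
      VarRelation k (MvPolynomial.X P - MvPolynomial.X V * MvPolynomial.X W)
  /-- `[Spec k] = 1` -/
  | point (V : Variety k) (h : IsIso V.obj.hom) :
      VarRelation k (MvPolynomial.X V - 1)

/-- The Grothendieck ring `K₀(Var_k)`: the commutative ring generated by the symbols `[V]`, for
`V` a `k`-variety, subject to the relations above. -/
abbrev KVar (k : Type u) [Field k] : Type (u + 1) :=
  MvPolynomial (Variety k) ℤ ⧸ Ideal.span {r | VarRelation k r}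

/-- The class (motive) `[V]` of a variety. -/
noncomputable def Variety.motive {k : Type u} [Field k] (V : Variety k) : KVar k :=
  Ideal.Quotient.mk _ (MvPolynomial.X V)

/-! ### Affine space and classes of its locally closed subsets -/

/-- Affine space over `k` with coordinates indexed by `σ`. -/
noncomputable abbrev affSpace (k : Type u) [Field k] (σ : Type) : Scheme.{u} :=
  Spec (CommRingCat.of (MvPolynomial σ k))

/-- The structure morphism of affine space. -/
noncomputable abbrev affSpaceHom (k : Type u) [Field k] (σ : Type) :
    affSpace k σ ⟶ Spec (CommRingCat.of k) :=
  Spec.map (CommRingCat.ofHom (algebraMap k (MvPolynomial σ k)))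

instance (k : Type u) [Field k] (σ : Type) [Finite σ] : LocallyOfFiniteType (affSpaceHom k σ) := by
  rw [HasRingHomProperty.Spec_iff (P := @LocallyOfFiniteType)]
  change (algebraMap k (MvPolynomial σ k)).FiniteType
  rw [RingHom.finiteType_algebraMap]
  infer_instance

/-- The largest open subset of `A` in which `S` is relatively closed. If `S` is locally closed,
this is `A` minus `closure S \ S`. -/
def ambientOpen {A : Scheme.{u}} (S : Set A) : A.Opens :=
  ⟨interior (coborder S), isOpen_interior⟩

/-- The ideal sheaf, on the open subscheme `ambientOpen S`, of all functions vanishing on `S`. -/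
noncomputable def reducedIdeal {A : Scheme.{u}} (S : Set A) :
    (ambientOpen S : Scheme.{u}).IdealSheafData :=
  Scheme.IdealSheafData.vanishingIdeal
    ⟨(ambientOpen S).ι ⁻¹' closure S, isClosed_closure.preimage (ambientOpen S).ι.continuous⟩

/-- A locally closed subset `S` of a scheme `A`, as a scheme with its reduced structure: the reduced
induced structure on `S`, which is closed in the open subscheme `ambientOpen S`. -/
noncomputable abbrev reducedSubscheme {A : Scheme.{u}} (S : Set A) : Scheme.{u} :=
  (reducedIdeal S).subscheme

/-- The immersion of `reducedSubscheme S` into `A`. -/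
noncomputable abbrev reducedSubschemeι {A : Scheme.{u}} (S : Set A) : reducedSubscheme S ⟶ A :=
  (reducedIdeal S).subschemeι ≫ (ambientOpen S).ι

/-- For locally closed `S`, the underlying set of `reducedSubscheme S` is `S`. -/
theorem range_reducedSubschemeι {A : Scheme.{u}} (S : Set A) (hS : IsLocallyClosed S) :
    Set.range (reducedSubschemeι S) = S := by
  rw [Scheme.Hom.comp_base, TopCat.coe_comp, Set.range_comp,
    Scheme.IdealSheafData.range_subschemeι, reducedIdeal,
    Scheme.IdealSheafData.coe_support_vanishingIdeal]
  change (ambientOpen S).ι '' ((ambientOpen S).ι ⁻¹' closure S) = S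
  rw [Set.image_preimage_eq_inter_range, Scheme.Opens.range_ι]
  change closure S ∩ interior (coborder S) = S
  rw [hS.isOpen_coborder.interior_eq, closure_inter_coborder]

/-- `reducedSubscheme S` is reduced. -/
theorem isReduced_reducedSubscheme {A : Scheme.{u}} (S : Set A) :
    IsReduced (reducedSubscheme S) := by
  have : ∀ i, IsReduced ((reducedIdeal S).subschemeCover.openCover.X i) := by
    intro U
    have hr : _root_.IsReduced (_ ⧸ (reducedIdeal S).ideal U) := by
      rw [← Ideal.isRadical_iff_quotient_reduced]
      exact PrimeSpectrum.isRadical_vanishingIdeal _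
    exact (affine_isReduced_iff (.of (_ ⧸ (reducedIdeal S).ideal U))).mpr hr
  exact IsReduced.of_openCover _ (reducedIdeal S).subschemeCover.openCover

instance {k : Type u} [Field k] {σ : Type} [Finite σ] (S : Set (affSpace k σ)) :
    QuasiCompact (reducedSubschemeι S) := by
  have : TopologicalSpace.NoetherianSpace (reducedSubscheme S) :=
    (reducedSubschemeι S).isEmbedding.isInducing.noetherianSpace
  infer_instance

/-- A locally closed subset `S` of affine space as a (reduced) `k`-variety. -/
noncomputable def subvariety {k : Type u} [Field k] {σ : Type} [Finite σ] (S : Set (affSpace k σ)) :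
    Variety k where
  obj := Over.mk (reducedSubschemeι S ≫ affSpaceHom k σ)
  locallyOfFiniteType := by dsimp; infer_instance
  quasiCompact := by dsimp; infer_instance
  isSeparated := by dsimp; infer_instance

/-- The affine line over `k`. -/
noncomputable def affineLine (k : Type u) [Field k] : Variety k where
  obj := Over.mk (affSpaceHom k Unit)
  locallyOfFiniteType := by dsimp; infer_instance
  quasiCompact := by dsimp; infer_instance
  isSeparated := by dsimp; infer_instance

/-- The Lefschetz motive `𝕃 = [𝔸¹]`. -/
noncomputable def lefschetz (k : Type u) [Field k] : KVar k := (affineLine k).motive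

/-! ### Varieties of pairs of matrices -/

/-- Coordinates on pairs `(X, Y)` of `d × d` matrices: `inl (i, j)` is the entry `X i j` and
`inr (i, j)` is the entry `Y i j`. -/
abbrev PairIndex (d : ℕ) : Type := (Fin d × Fin d) ⊕ (Fin d × Fin d)

/-- The affine space `Mat_d × Mat_d` over `k`. -/
noncomputable abbrev PairSpace (k : Type u) [Field k] (d : ℕ) : Scheme.{u} :=
  affSpace k (PairIndex d)

/-- The residue field of a point of `Mat_d × Mat_d`. -/
abbrev kappa {k : Type u} [Field k] {d : ℕ}
    (x : PrimeSpectrum (MvPolynomial (PairIndex d) k)) : Type u :=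
  x.asIdeal.ResidueField

/-- The matrix `X` at a point of `Mat_d × Mat_d`. -/
noncomputable def matX {k : Type u} [Field k] {d : ℕ}
    (x : PrimeSpectrum (MvPolynomial (PairIndex d) k)) : Matrix (Fin d) (Fin d) (kappa x) :=
  Matrix.of fun i j => algebraMap (MvPolynomial (PairIndex d) k) (kappa x)
    (MvPolynomial.X (Sum.inl (i, j)))

/-- The matrix `Y` at a point of `Mat_d × Mat_d`. -/
noncomputable def matY {k : Type u} [Field k] {d : ℕ}
    (x : PrimeSpectrum (MvPolynomial (PairIndex d) k)) : Matrix (Fin d) (Fin d) (kappa x) :=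
  Matrix.of fun i j => algebraMap (MvPolynomial (PairIndex d) k) (kappa x)
    (MvPolynomial.X (Sum.inr (i, j)))

/-- The set of points of `Mat_d × Mat_d` (over `k`) at which the pair of matrices has property
`P`. -/
def locus (k : Type u) [Field k] (d : ℕ)
    (P : ∀ {K : Type u} [Field K], Matrix (Fin d) (Fin d) K → Matrix (Fin d) (Fin d) K → Prop) :
    Set (PairSpace k d) :=
  {x : PrimeSpectrum (MvPolynomial (PairIndex d) k) | P (matX x) (matY x)}

/-- `X² = Y³` and `XY = YX`. -/
def CuspEquations {d : ℕ} {K : Type u} [Field K] (X Y : Matrix (Fin d) (Fin d) K) : Prop :=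
  X ^ 2 = Y ^ 3 ∧ X * Y = Y * X

/-- All entries on and below the diagonal vanish. -/
def StrictlyUpper {d : ℕ} {K : Type u} [Field K] (X : Matrix (Fin d) (Fin d) K) : Prop :=
  ∀ i j, j ≤ i → X i j = 0

/-- `V_d`: pairs of strictly upper triangular `d × d` matrices with `X² = Y³`, `XY = YX`. -/
def stairV (k : Type u) [Field k] (d : ℕ) : Set (PairSpace k d) :=
  locus k d fun X Y => StrictlyUpper X ∧ StrictlyUpper Y ∧ CuspEquations X Y

/-- The `2d × 2d` block matrix `[[X, -Y²], [-Y, X]]`. -/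
def matA {d : ℕ} {K : Type u} [Field K] (X Y : Matrix (Fin d) (Fin d) K) :
    Matrix (Fin d ⊕ Fin d) (Fin d ⊕ Fin d) K :=
  Matrix.fromBlocks X (-(Y ^ 2)) (-Y) X

/-- The stratum of `V_d` on which `matA X Y` has a kernel of dimension `a` and an image of
dimension `b`. -/
def stratumIn (k : Type u) [Field k] (d : ℕ) (a b : ℤ) : Set (PairSpace k d) :=
  locus k d fun {K} _ X Y => (StrictlyUpper X ∧ StrictlyUpper Y ∧ CuspEquations X Y) ∧
    (Module.finrank K (LinearMap.ker (matA X Y).mulVecLin) : ℤ) = a ∧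
    (Module.finrank K (LinearMap.range (matA X Y).mulVecLin) : ℤ) = b

/-- `[V_d]`. -/
noncomputable def motiveV (k : Type u) [Field k] (d : ℕ) : KVar k :=
  (subvariety (stairV k d)).motive

/-- `[V_{(a,b)}]`, where `V_{(a,b)}` is the stratum of `V_d` with kernel dimension `a` and image
dimension `b`, and `d = (a + b) / 2`. (If `a + b` is odd or negative, no point of any `V_d`
satisfies both conditions, and the stratum is empty.) -/
noncomputable def motiveStratum (k : Type u) [Field k] (a b : ℤ) : KVar k :=
  (subvariety (stratumIn k ((a + b) / 2).toNat a b)).motive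

/-- The inductive formula, for a family `v (a, b)` in a commutative ring with an element `L`.
The exponents of the recursion are nonnegative, except `b - 1` when `b = 0`, where the middle
term is zero because `v (a - 1, -1) = 0`. -/
def StaircaseRecursion {R : Type*} [CommRing R] (L : R) (v : ℤ → ℤ → R) : Prop :=
  v 0 0 = 1 ∧
  (∀ a b : ℤ, ¬ (b ≤ a ∧ 0 ≤ b ∧ a ≡ b [ZMOD 2]) → v a b = 0) ∧
  (∀ a b : ℤ, b ≤ a → 0 ≤ b → a ≡ b [ZMOD 2] → (a, b) ≠ (0, 0) →
    v a b = L ^ b.toNat * v (a - 2) b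
      + (L ^ ((a + b - 2) / 2).toNat - L ^ (b - 1).toNat) * v (a - 1) (b - 1)
      + (L ^ a.toNat - L ^ ((a + b - 2) / 2).toNat) * v a (b - 2))

/-! ### Leading term data -/

/-- The nonzero proper monomial ideals of `k[[T²,T³]]`: `J a = (T^(a+1))` for `a ≥ 1` and
`K a = (T^(a+2), T^(a+3))` for `a ≥ 0`. The constructor is also called the color of the ideal. -/
inductive MonIdeal : Type
  | J (a : ℕ+) : MonIdeal
  | K (a : ℕ) : MonIdeal

/-- The level: `a - 1` for `J a`, and `a` for `K a`. -/
def MonIdeal.level : MonIdeal → ℕ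
  | .J a => (a : ℕ) - 1
  | .K a => a

/-- The exponent of the lowest monomial `μ⁰`: `a + 1` for `J a`, and `a + 2` for `K a`. -/
def MonIdeal.mu0 : MonIdeal → ℕ
  | .J a => (a : ℕ) + 1
  | .K a => a + 2

/-- The ideal has color `J`. -/
def MonIdeal.IsJ : MonIdeal → Prop
  | .J _ => True
  | .K _ => False

/-- The ideal has color `K`. -/
def MonIdeal.IsK : MonIdeal → Prop
  | .J _ => False
  | .K _ => True

/-- A leading term datum of rank `d`: the monomial submodule `I_1 u_1 ⊕ ⋯ ⊕ I_d u_d`. -/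
abbrev LeadingDatum (d : ℕ) : Type := Fin d → MonIdeal

/-- The monomial `T^n u_i` of `k[[T]]^d`. Monomials are ordered first by the exponent `n`, then by
the index `i`. -/
abbrev mono {d : ℕ} (n : ℕ) (i : Fin d) : ℕ ×ₗ Fin d := toLex (n, i)

/-- The datum is pure-`K`: all its components have color `K`. -/
def LeadingDatum.PureK {d : ℕ} (α : LeadingDatum d) : Prop := ∀ i, (α i).IsK

/-- The seat of the component of rank `h`, when the components are sorted in ascending order of
their monomials `μ⁰_i`. -/
def LeadingDatum.seat {d : ℕ} (α : LeadingDatum d) : Equiv.Perm (Fin d) :=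
  Tuple.sort fun i => mono (α i).mu0 i

/-- The distance between the components of rank `b` and `h`, for `b < h`: the floor of
`(l_j + j/d) - (l_i + i/d)`, where `i`, `j` are their seats and `l_i`, `l_j` their levels. -/
def LeadingDatum.dist {d : ℕ} (α : LeadingDatum d) (b h : Fin d) : ℤ :=
  ⌊(((α (α.seat h)).level : ℚ) + ((α.seat h : ℕ) : ℚ) / d)
    - (((α (α.seat b)).level : ℚ) + ((α.seat b : ℕ) : ℚ) / d)⌋

/-- The datum is stable under the spiral raising operator `γ_(j)`. -/
def LeadingDatum.Stable {d : ℕ} (α : LeadingDatum d) (j : Fin d) : Prop :=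
  ∀ b h : Fin d, b < j → j ≤ h →
    ((α (α.seat b)).IsJ → 1 ≤ α.dist b h) ∧
    ((α (α.seat b)).IsK → (α (α.seat h)).IsK → 3 ≤ α.dist b h)

/-- `V(α)`, for a pure-`K` datum `α`: pairs `(X, Y)` with `X² = Y³`, `XY = YX`, and with
`X i j = 0` if `μ⁰_j ≺ T³ μ⁰_i`, and `Y i j = 0` if `μ⁰_j ≺ T² μ⁰_i`. -/
def datumV (k : Type u) [Field k] {d : ℕ} (α : LeadingDatum d) : Set (PairSpace k d) :=
  locus k d fun X Y => CuspEquations X Y ∧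
    (∀ i j, mono (α j).mu0 j < mono ((α i).mu0 + 3) i → X i j = 0) ∧
    (∀ i j, mono (α j).mu0 j < mono ((α i).mu0 + 2) i → Y i j = 0)

/-- `[V(α)]`. -/
noncomputable def motiveDatum (k : Type u) [Field k] {d : ℕ} (α : LeadingDatum d) : KVar k :=
  (subvariety (datumV k α)).motive

end CuspStaircase

namespace CuspStaircase

/-! ### Reduced immersions are determined by their range -/

theorem ker_eq_vanishingIdeal {X Y : Scheme.{u}} (f : X ⟶ Y) [IsClosedImmersion f] [IsReduced X] :
    f.ker = Scheme.IdealSheafData.vanishingIdeal ⟨Set.range f, f.isClosedEmbedding.isClosed_range⟩ := by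
  have h := Scheme.IdealSheafData.map_vanishingIdeal f ⊤
  rw [Scheme.IdealSheafData.vanishingIdeal_top, Scheme.nilradical_eq_bot,
    Scheme.IdealSheafData.map_bot] at h
  rw [h]
  congr 1
  ext1
  simp [f.isClosedEmbedding.isClosed_range.closure_eq]

theorem exists_iso_of_range_eq {X Y A : Scheme.{u}} (f : X ⟶ A) (g : Y ⟶ A)
    [IsImmersion f] [IsImmersion g] [IsReduced X] [IsReduced Y] (h : Set.range f = Set.range g) :
    ∃ e : X ≅ Y, e.hom ≫ g = f := by
  have hU : Set.range g ⊆ Set.range f.coborderRange.ι := by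
    rw [← h]
    simpa using! subset_coborder
  let g' := IsOpenImmersion.lift f.coborderRange.ι g hU
  have hg' : g' ≫ f.coborderRange.ι = g := IsOpenImmersion.lift_fac _ _ _
  have hpre : IsPreimmersion (g' ≫ f.coborderRange.ι) := by rw [hg']; infer_instance
  have hpre' : IsPreimmersion g' := .of_comp g' f.coborderRange.ι
  have hr : Set.range f.liftCoborder = Set.range g' := by
    apply Set.image_injective.mpr f.coborderRange.ι.isEmbedding.injective
    rw [← Set.range_comp, ← Set.range_comp, ← TopCat.coe_comp, ← TopCat.coe_comp,
      ← Scheme.Hom.comp_base, ← Scheme.Hom.comp_base, f.liftCoborder_ι, hg', h]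
  have hcl : IsClosedImmersion g' :=
    .of_isPreimmersion g' (hr ▸ f.liftCoborder.isClosedEmbedding.isClosed_range)
  have hk : g'.ker = f.liftCoborder.ker := by
    rw [ker_eq_vanishingIdeal, ker_eq_vanishingIdeal]
    congr 1
    ext1
    exact hr.symm
  have := IsClosedImmersion.isIso_lift g' f.liftCoborder hk
  refine ⟨asIso (IsClosedImmersion.lift g' f.liftCoborder hk.le), ?_⟩
  rw [asIso_hom, ← hg', IsClosedImmersion.lift_fac_assoc, f.liftCoborder_ι]

/-! ### Relations in the Grothendieck ring -/

section Motive

variable {k : Type u} [Field k]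

/-- The class of the variety with structure morphism `g`. -/
noncomputable def motiveHom {X : Scheme.{u}} (g : X ⟶ Spec (CommRingCat.of k))
    [h₁ : LocallyOfFiniteType g] [h₂ : QuasiCompact g] [h₃ : IsSeparated g] : KVar k :=
  (Variety.mk (Over.mk g) h₁ h₂ h₃).motive

variable {X Y Z : Scheme.{u}} (f : X ⟶ Spec (CommRingCat.of k)) (g : Y ⟶ Spec (CommRingCat.of k))
  (h : Z ⟶ Spec (CommRingCat.of k)) [LocallyOfFiniteType f] [QuasiCompact f] [IsSeparated f]
  [LocallyOfFiniteType g] [QuasiCompact g] [IsSeparated g]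
  [LocallyOfFiniteType h] [QuasiCompact h] [IsSeparated h]

theorem motiveHom_eq_of_iso (e : X ≅ Y) (he : e.hom ≫ g = f) : motiveHom f = motiveHom g := by
  rw [motiveHom, motiveHom, Variety.motive, Variety.motive, Ideal.Quotient.eq]
  exact Ideal.subset_span (.iso _ _ (Over.isoMk e he))

theorem motiveHom_eq_add (i : Y ⟶ X) (j : Z ⟶ X) [hi : IsClosedImmersion i] [hj : IsOpenImmersion j]
    (hig : i ≫ f = g) (hjh : j ≫ f = h) (hc : Set.range j = (Set.range i)ᶜ) :
    motiveHom f = motiveHom g + motiveHom h := by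
  rw [motiveHom, motiveHom, motiveHom, Variety.motive, Variety.motive, Variety.motive, ← map_add,
    Ideal.Quotient.eq]
  exact Ideal.subset_span (.scissor _ _ _ (Over.homMk i hig) (Over.homMk j hjh) hi hj hc)

theorem motiveHom_eq_mul {p : Z ⟶ X} {q : Z ⟶ Y} (hp : IsPullback p q f g) (hh : p ≫ f = h) :
    motiveHom h = motiveHom f * motiveHom g := by
  rw [motiveHom, motiveHom, motiveHom, Variety.motive, Variety.motive, Variety.motive, ← map_mul,
    Ideal.Quotient.eq]
  exact Ideal.subset_span (.prod _ _ _ (Over.homMk p hh)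
    (Over.homMk q (by exact hp.w.symm.trans hh)) hp)

theorem motiveHom_eq_one [hf : IsIso f] : motiveHom f = 1 := by
  rw [motiveHom, Variety.motive, ← map_one (Ideal.Quotient.mk _), Ideal.Quotient.eq]
  exact Ideal.subset_span (.point _ hf)

variable {σ : Type} [Finite σ]

theorem motive_subvariety (S : Set (affSpace k σ)) :
    (subvariety S).motive = motiveHom (reducedSubschemeι S ≫ affSpaceHom k σ) :=
  rfl

theorem motive_subvariety_eq {S : Set (affSpace k σ)} (i : X ⟶ affSpace k σ) [IsImmersion i]
    [IsReduced X] (hi : i ≫ affSpaceHom k σ = f) (hS : Set.range i = S) :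
    (subvariety S).motive = motiveHom f := by
  subst hS
  have : IsReduced (reducedSubscheme (Set.range i)) := isReduced_reducedSubscheme _
  obtain ⟨e, he⟩ := exists_iso_of_range_eq (reducedSubschemeι (Set.range i)) i
    (range_reducedSubschemeι _ i.isLocallyClosed_range)
  rw [motive_subvariety]
  refine motiveHom_eq_of_iso _ _ e ?_
  rw [← hi, ← Category.assoc, he]

theorem isReduced_subscheme_vanishingIdeal (T : TopologicalSpace.Closeds X) :
    IsReduced (Scheme.IdealSheafData.vanishingIdeal T).subscheme := by
  have : ∀ j, IsReduced
      ((Scheme.IdealSheafData.vanishingIdeal T).subschemeCover.openCover.X j) := by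
    intro W
    have hr : _root_.IsReduced (_ ⧸ (Scheme.IdealSheafData.vanishingIdeal T).ideal W) := by
      rw [← Ideal.isRadical_iff_quotient_reduced]
      exact PrimeSpectrum.isRadical_vanishingIdeal _
    exact (affine_isReduced_iff (.of (_ ⧸ _))).mpr hr
  exact IsReduced.of_openCover _ (Scheme.IdealSheafData.vanishingIdeal T).subschemeCover.openCover

theorem motive_subvariety_add {S : Set (affSpace k σ)} (hS : IsLocallyClosed S)
    {Z : Set (affSpace k σ)} (hZ : IsClosed Z) :
    (subvariety S).motive = (subvariety (S ∩ Z)).motive + (subvariety (S \ Z)).motive := by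
  let f := reducedSubschemeι S
  have hred : IsReduced (reducedSubscheme S) := isReduced_reducedSubscheme S
  let T : TopologicalSpace.Closeds (reducedSubscheme S) := ⟨f ⁻¹' Z, hZ.preimage f.continuous⟩
  let i := (Scheme.IdealSheafData.vanishingIdeal T).subschemeι
  have hi : Set.range i = f ⁻¹' Z := by
    rw [Scheme.IdealSheafData.range_subschemeι, Scheme.IdealSheafData.coe_support_vanishingIdeal]
    rfl
  let U : (reducedSubscheme S).Opens := ⟨(f ⁻¹' Z)ᶜ, T.isClosed.isOpen_compl⟩
  have hnoeth : TopologicalSpace.NoetherianSpace (reducedSubscheme S) :=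
    (reducedSubschemeι S).isEmbedding.isInducing.noetherianSpace
  have hnoeth' : TopologicalSpace.NoetherianSpace U.toScheme :=
    U.ι.isEmbedding.isInducing.noetherianSpace
  have hU : QuasiCompact U.ι := inferInstance
  have hjr : Set.range U.ι = (Set.range i)ᶜ := by
    rw [hi, Scheme.Opens.range_ι]
    rfl
  have hri : IsReduced (Scheme.IdealSheafData.vanishingIdeal T).subscheme :=
    isReduced_subscheme_vanishingIdeal T
  have hf : Set.range f = S := range_reducedSubschemeι S hS
  have h1 : (subvariety (S ∩ Z)).motive = motiveHom (i ≫ f ≫ affSpaceHom k σ) := by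
    refine motive_subvariety_eq _ (i ≫ f) (Category.assoc _ _ _) ?_
    rw [Scheme.Hom.comp_base, TopCat.coe_comp, Set.range_comp, hi,
      Set.image_preimage_eq_inter_range, hf, Set.inter_comm]
  have h2 : (subvariety (S \ Z)).motive = motiveHom (U.ι ≫ f ≫ affSpaceHom k σ) := by
    have : IsReduced U.toScheme := isReduced_of_isOpenImmersion U.ι
    refine motive_subvariety_eq _ (U.ι ≫ f) (Category.assoc _ _ _) ?_
    rw [Scheme.Hom.comp_base, TopCat.coe_comp, Set.range_comp, hjr, hi, ← Set.preimage_compl,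
      Set.image_preimage_eq_inter_range, hf, Set.inter_comm, Set.sdiff_eq]
  rw [h1, h2, motive_subvariety]
  exact motiveHom_eq_add _ _ _ i U.ι rfl rfl hjr

theorem motive_subvariety_empty : (subvariety (∅ : Set (affSpace k σ))).motive = 0 := by
  have h := motive_subvariety_add (k := k) (σ := σ) (S := ∅)
    isClosed_empty.isLocallyClosed isClosed_empty
  rw [Set.inter_empty, Set.sdiff_empty] at h
  simpa using h

end Motive

section Affine

variable (k : Type u) [Field k]

instance locallyOfFiniteType_specMap (R : Type u) [CommRing R] [Algebra k R]
    [Algebra.FiniteType k R] :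
    LocallyOfFiniteType (Spec.map (CommRingCat.ofHom (algebraMap k R))) := by
  rw [HasRingHomProperty.Spec_iff (P := @LocallyOfFiniteType)]
  change (algebraMap k R).FiniteType
  rw [RingHom.finiteType_algebraMap]
  infer_instance

/-- The class of the spectrum of a finitely generated algebra. -/
noncomputable def motiveSpec (R : Type u) [CommRing R] [Algebra k R] [Algebra.FiniteType k R] :
    KVar k :=
  motiveHom (Spec.map (CommRingCat.ofHom (algebraMap k R)))

theorem motiveSpec_congr {R S : Type u} [CommRing R] [Algebra k R] [Algebra.FiniteType k R]
    [CommRing S] [Algebra k S] [Algebra.FiniteType k S] (e : R ≃ₐ[k] S) :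
    motiveSpec k R = motiveSpec k S := by
  refine motiveHom_eq_of_iso _ _ (Scheme.Spec.mapIso e.toRingEquiv.toCommRingCatIso.symm.op) ?_
  change Spec.map (CommRingCat.ofHom (e.symm : S →+* R)) ≫ _ = _
  rw [← Spec.map_comp, ← CommRingCat.ofHom_comp]
  congr 2
  ext x
  exact e.symm.commutes x

theorem motiveSpec_self : motiveSpec k k = 1 := by
  have : IsIso (Spec.map (CommRingCat.ofHom (algebraMap k k))) := by
    change IsIso (Spec.map (𝟙 (CommRingCat.of k)))
    infer_instance
  exact motiveHom_eq_one _

attribute [local instance] MvPolynomial.algebraMvPolynomial in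
theorem motiveSpec_mvPolynomial_unit (R : Type u) [CommRing R] [Algebra k R]
    [Algebra.FiniteType k R] :
    motiveSpec k (MvPolynomial Unit R) = motiveSpec k R * lefschetz k := by
  refine motiveHom_eq_mul
    (p := Spec.map (CommRingCat.ofHom (algebraMap R (MvPolynomial Unit R))))
    (q := Spec.map (CommRingCat.ofHom (algebraMap (MvPolynomial Unit k) (MvPolynomial Unit R))))
    _ (affSpaceHom k Unit) _ ?_ ?_
  · exact isPullback_SpecMap_of_isPushout _ _ _ _
      (CommRingCat.isPushout_of_isPushout k R (MvPolynomial Unit k) (MvPolynomial Unit R))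
  · rw [← Spec.map_comp, ← CommRingCat.ofHom_comp, ← IsScalarTower.algebraMap_eq]

theorem motiveSpec_mvPolynomial (n : ℕ) (R : Type u) [CommRing R] [Algebra k R]
    [Algebra.FiniteType k R] :
    motiveSpec k (MvPolynomial (Fin n) R) = lefschetz k ^ n * motiveSpec k R := by
  induction n with
  | zero =>
    rw [pow_zero, one_mul]
    exact motiveSpec_congr k ((MvPolynomial.isEmptyAlgEquiv R (Fin 0)).restrictScalars k)
  | succ n ih =>
    have e : MvPolynomial (Fin (n + 1)) R ≃ₐ[R] MvPolynomial Unit (MvPolynomial (Fin n) R) :=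
      (MvPolynomial.finSuccEquiv R n).trans
        ((MvPolynomial.uniqueAlgEquiv (MvPolynomial (Fin n) R) Unit).symm.restrictScalars R)
    rw [motiveSpec_congr k (e.restrictScalars k), motiveSpec_mvPolynomial_unit, ih, pow_succ]
    ring

variable {k}

theorem isImmersion_specMap {A B : Type u} [CommRing A] [CommRing B] (φ : A →+* B) (g : A)
    (hg : IsUnit (φ g)) (hφ : ∀ b, ∃ a n, φ a = b * φ g ^ n) :
    IsImmersion (Spec.map (CommRingCat.ofHom φ)) := by
  let ψ : Localization.Away g →+* B := IsLocalization.Away.lift g hg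
  have hψ : ψ.comp (algebraMap A (Localization.Away g)) = φ := IsLocalization.Away.lift_comp g hg
  have hs : Function.Surjective ψ := by
    intro b
    obtain ⟨a, n, h⟩ := hφ b
    refine ⟨IsLocalization.mk' _ a (⟨g ^ n, n, rfl⟩ : Submonoid.powers g), ?_⟩
    have h2 := congrArg ψ (IsLocalization.mk'_spec (Localization.Away g) a
      (⟨g ^ n, n, rfl⟩ : Submonoid.powers g))
    have hφψ : ∀ x, ψ (algebraMap A _ x) = φ x := fun x => RingHom.congr_fun hψ x
    rw [map_mul, hφψ, hφψ, h, map_pow] at h2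
    exact (hg.pow n).mul_right_cancel h2
  have h1 : IsClosedImmersion (Spec.map (CommRingCat.ofHom ψ)) :=
    IsClosedImmersion.spec_of_surjective _ hs
  have h2 : IsOpenImmersion (Spec.map (CommRingCat.ofHom (algebraMap A (Localization.Away g)))) :=
    inferInstance
  rw [← hψ, CommRingCat.ofHom_comp, Spec.map_comp]
  infer_instance

theorem motive_subvariety_eq_motiveSpec {σ : Type} [Finite σ] {B : Type u} [CommRing B]
    [Algebra k B] [Algebra.FiniteType k B] [_root_.IsReduced B] (φ : MvPolynomial σ k →ₐ[k] B)
    (g : MvPolynomial σ k) (hg : IsUnit (φ g)) (hφ : ∀ b, ∃ a n, φ a = b * φ g ^ n)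
    {S : Set (affSpace k σ)} (hS : Set.range (PrimeSpectrum.comap (φ : MvPolynomial σ k →+* B)) = S) :
    (subvariety S).motive = motiveSpec k B := by
  have := isImmersion_specMap (φ : MvPolynomial σ k →+* B) g hg hφ
  have : IsReduced (Spec (CommRingCat.of B)) := (affine_isReduced_iff (.of B)).mpr ‹_›
  refine motive_subvariety_eq _ (Spec.map (CommRingCat.ofHom (φ : MvPolynomial σ k →+* B))) ?_ hS
  rw [← Spec.map_comp, ← CommRingCat.ofHom_comp]
  congr 2
  exact φ.comp_algebraMap

end Affine

/-! ### Noetherian induction for additive functions of locally closed sets -/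

/-- Additivity of a function of locally closed sets. -/
def ScissorAdditive {X M : Type*} [TopologicalSpace X] [AddCommGroup M] (F : Set X → M) : Prop :=
  ∀ E Z : Set X, IsLocallyClosed E → IsClosed Z → F E = F (E ∩ Z) + F (E \ Z)

theorem ScissorAdditive.eq_of_generic {X M : Type*} [TopologicalSpace X]
    [TopologicalSpace.NoetherianSpace X] [QuasiSober X] [AddCommGroup M] {F G : Set X → M}
    (hF : ScissorAdditive F) (hG : ScissorAdditive G)
    (h : ∀ x : X, ∃ W : Set X, IsClosed W ∧ x ∉ W ∧ F (closure {x} \ W) = G (closure {x} \ W))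
    {Z : Set X} (hZ : IsClosed Z) : F Z = G Z := by
  have key : ∀ Z : TopologicalSpace.Closeds X, F Z = G Z := by
    intro Z
    induction Z using WellFoundedLT.induction with | _ Z ih => ?_
    have ih' : ∀ Z' : Set X, IsClosed Z' → Z' ⊂ Z → F Z' = G Z' := fun Z' hc hlt => ih ⟨Z', hc⟩ hlt
    by_cases hirr : IsIrreducible (Z : Set X)
    · obtain ⟨x, hx⟩ := QuasiSober.sober hirr Z.isClosed
      obtain ⟨W, hW, hxW, hFG⟩ := h x
      rw [hx.def] at hFG
      have hxZ : x ∈ (Z : Set X) := by rw [← hx.def]; exact subset_closure rfl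
      rw [hF _ W Z.isClosed.isLocallyClosed hW, hG _ W Z.isClosed.isLocallyClosed hW, hFG,
        ih' _ (Z.isClosed.inter hW)
          ⟨Set.inter_subset_left, fun hsub => hxW (hsub hxZ).2⟩]
    · by_cases hne : (Z : Set X).Nonempty
      · have hpre : ¬ IsPreirreducible (Z : Set X) := fun hp => hirr ⟨hne, hp⟩
        rw [isPreirreducible_iff_isClosed_union_isClosed] at hpre
        push Not at hpre
        obtain ⟨Z₁, Z₂, h₁, h₂, hsub, hn₁, hn₂⟩ := hpre
        have hd : (Z : Set X) \ Z₁ = ((Z : Set X) ∩ Z₂) \ Z₁ := by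
          ext y
          refine ⟨fun hy => ⟨⟨hy.1, (hsub hy.1).resolve_left hy.2⟩, hy.2⟩, fun hy => ⟨hy.1.1, hy.2⟩⟩
        have e₁ := ih' ((Z : Set X) ∩ Z₁) (Z.isClosed.inter h₁)
          ⟨Set.inter_subset_left, fun hs => hn₁ fun y hy => (hs hy).2⟩
        have e₂ := ih' ((Z : Set X) ∩ Z₂) (Z.isClosed.inter h₂)
          ⟨Set.inter_subset_left, fun hs => hn₂ fun y hy => (hs hy).2⟩
        have e₃ := ih' (((Z : Set X) ∩ Z₂) ∩ Z₁) ((Z.isClosed.inter h₂).inter h₁)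
          ⟨fun y hy => hy.1.1, fun hs => hn₂ fun y hy => (hs hy).1.2⟩
        have f₁ := hF _ Z₁ (Z.isClosed.inter h₂).isLocallyClosed h₁
        have f₂ := hG _ Z₁ (Z.isClosed.inter h₂).isLocallyClosed h₁
        rw [hF _ Z₁ Z.isClosed.isLocallyClosed h₁, hG _ Z₁ Z.isClosed.isLocallyClosed h₁, hd, e₁]
        rw [e₂, e₃, f₂] at f₁
        rw [add_left_cancel f₁]
      · rw [Set.not_nonempty_iff_eq_empty.mp hne]
        have f₁ := hF ∅ ∅ isClosed_empty.isLocallyClosed isClosed_empty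
        have f₂ := hG ∅ ∅ isClosed_empty.isLocallyClosed isClosed_empty
        simp only [Set.inter_empty, Set.sdiff_empty, left_eq_add] at f₁ f₂
        rw [f₁, f₂]
  exact key ⟨Z, hZ⟩

/-! ### Points of affine space with values in a field -/

section Points

variable {k : Type u} [Field k]

/-- The point of affine space with coordinates `v` in an extension field. -/
noncomputable def pt {σ : Type} {K : Type u} [Field K] [Algebra k K] (v : σ → K) : affSpace k σ :=
  PrimeSpectrum.comap (MvPolynomial.aeval (R := k) v : MvPolynomial σ k →+* K) ⊥

/-- The residue field of a point of affine space. -/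
abbrev resField {σ : Type} (x : affSpace k σ) : Type u :=
  (show PrimeSpectrum (MvPolynomial σ k) from x).asIdeal.ResidueField

/-- The coordinates of a point of affine space, in its residue field. -/
noncomputable def coords {σ : Type} (x : affSpace k σ) : σ → resField x :=
  fun s => algebraMap (MvPolynomial σ k) (resField x) (MvPolynomial.X s)

theorem aeval_coords {σ : Type} (x : affSpace k σ) (p : MvPolynomial σ k) :
    MvPolynomial.aeval (coords x) p = algebraMap _ (resField x) p := by
  have : MvPolynomial.aeval (coords x) = IsScalarTower.toAlgHom k (MvPolynomial σ k) (resField x) := by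
    ext s
    simp [coords]
  rw [this]
  rfl

theorem pt_coords {σ : Type} (x : affSpace k σ) : pt (coords x) = x := by
  apply PrimeSpectrum.ext
  ext p
  change MvPolynomial.aeval (coords x) p = 0 ↔ _
  rw [aeval_coords, Ideal.algebraMap_residueField_eq_zero]

/-- The hypersurface in affine space defined by a polynomial. -/
def hypersurface {σ : Type} (p : MvPolynomial σ k) : Set (affSpace k σ) :=
  {x | p ∈ (show PrimeSpectrum (MvPolynomial σ k) from x).asIdeal}

theorem isClosed_hypersurface {σ : Type} (p : MvPolynomial σ k) : IsClosed (hypersurface p) := by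
  have h : hypersurface p = PrimeSpectrum.zeroLocus {p} := by
    ext x
    exact (Set.singleton_subset_iff (s := (SetLike.coe x.asIdeal : Set (MvPolynomial σ k)))).symm
  rw [h]
  exact PrimeSpectrum.isClosed_zeroLocus _

theorem pt_mem_hypersurface {σ : Type} {K : Type u} [Field K] [Algebra k K] {v : σ → K}
    {p : MvPolynomial σ k} : pt v ∈ hypersurface p ↔ MvPolynomial.aeval v p = 0 :=
  Iff.rfl

theorem pt_mem_closure {σ : Type} {K L : Type u} [Field K] [Algebra k K] [Field L] [Algebra k L]
    {v : σ → K} {w : σ → L} : pt (k := k) w ∈ closure {pt (k := k) v} ↔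
      ∀ p : MvPolynomial σ k, MvPolynomial.aeval v p = 0 → MvPolynomial.aeval w p = 0 := by
  rw [← specializes_iff_mem_closure]
  exact (PrimeSpectrum.le_iff_specializes _ _).symm

/-- A closed set missing a point is contained in a hypersurface missing this point. -/
theorem exists_hypersurface {σ : Type} {S : Set (affSpace k σ)} (hS : IsClosed S)
    {x : affSpace k σ} (hx : x ∉ S) :
    ∃ p : MvPolynomial σ k, x ∉ hypersurface p ∧ S ⊆ hypersurface p := by
  obtain ⟨s, hs⟩ := (PrimeSpectrum.isClosed_iff_zeroLocus (R := MvPolynomial σ k) S).mp hS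
  subst hs
  obtain ⟨p, hp, hpx⟩ := Set.not_subset.mp hx
  exact ⟨p, hpx, fun y hy => hy hp⟩

/-- The restriction of coordinates along `f`. -/
noncomputable def reindexMap (k : Type u) [Field k] {σ τ : Type} (f : σ → τ) :
    affSpace k τ → affSpace k σ :=
  PrimeSpectrum.comap (MvPolynomial.rename f : MvPolynomial σ k →ₐ[k] MvPolynomial τ k).toRingHom

theorem continuous_reindexMap {σ τ : Type} (f : σ → τ) : Continuous (reindexMap k f) :=
  PrimeSpectrum.continuous_comap _

theorem reindexMap_pt {σ τ : Type} {K : Type u} [Field K] [Algebra k K] (f : σ → τ) (v : τ → K) :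
    reindexMap k f (pt v) = pt (v ∘ f) := by
  apply PrimeSpectrum.ext
  ext p
  change MvPolynomial.aeval v (MvPolynomial.rename f p) = 0 ↔ MvPolynomial.aeval (v ∘ f) p = 0
  rw [MvPolynomial.aeval_rename]

end Points

section Chart

variable {k : Type u} [Field k]

/-- The elements of the form `φ a / φ g ^ n`. -/
def fractionSubalgebra {A B : Type*} [CommRing A] [Algebra k A] [CommRing B] [Algebra k B]
    (φ : A →ₐ[k] B) (g : A) : Subalgebra k B where
  carrier := {b | ∃ a n, φ a = b * φ g ^ n}
  mul_mem' := by
    rintro b c ⟨a, n, h⟩ ⟨a', n', h'⟩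
    exact ⟨a * a', n + n', by rw [map_mul, h, h']; ring⟩
  add_mem' := by
    rintro b c ⟨a, n, h⟩ ⟨a', n', h'⟩
    exact ⟨a * g ^ n' + a' * g ^ n, n + n', by simp only [map_add, map_mul, map_pow, h, h']; ring⟩
  algebraMap_mem' := fun r => ⟨algebraMap k A r, 0, by simp⟩

theorem map_mem_fractionSubalgebra {A B : Type*} [CommRing A] [Algebra k A] [CommRing B]
    [Algebra k B] (φ : A →ₐ[k] B) (g a : A) : φ a ∈ fractionSubalgebra φ g :=
  ⟨a, 0, by simp⟩

/-- The localization map onto an algebra of fractions `φ a / φ g ^ n`. -/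
theorem exists_surjective_away {A B : Type*} [CommRing A] [Algebra k A] [CommRing B] [Algebra k B]
    (φ : A →ₐ[k] B) (g : A) (hg : IsUnit (φ g)) (hφ : ∀ b, b ∈ fractionSubalgebra φ g) :
    ∃ ψ : Localization.Away g →ₐ[k] B, Function.Surjective ψ ∧
      ∀ a, ψ (algebraMap A _ a) = φ a := by
  have hu : ∀ y : Submonoid.powers g, IsUnit (φ y) := by
    rintro ⟨_, n, rfl⟩
    simpa using hg.pow n
  let ψ : Localization.Away g →ₐ[k] B := IsLocalization.liftAlgHom (M := Submonoid.powers g) hu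
  have hψ : ∀ a, ψ (algebraMap A _ a) = φ a := fun a => IsLocalization.lift_eq _ a
  refine ⟨ψ, fun b => ?_, hψ⟩
  obtain ⟨a, n, h⟩ := hφ b
  refine ⟨IsLocalization.mk' _ a (⟨g ^ n, n, rfl⟩ : Submonoid.powers g), ?_⟩
  have h2 := congrArg ψ (IsLocalization.mk'_spec (Localization.Away g) a
    (⟨g ^ n, n, rfl⟩ : Submonoid.powers g))
  rw [map_mul, hψ, hψ, h, map_pow] at h2
  exact (hg.pow n).mul_right_cancel h2

theorem exists_chart {σ : Type} [Finite σ] {J : Type} [Finite J] (x : affSpace k σ)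
    (c : J → resField x) :
    ∃ (B : Subalgebra k (resField x)) (φ : MvPolynomial σ k →ₐ[k] B) (g : MvPolynomial σ k)
      (_ : Algebra.FiniteType k B),
      (∀ a, (φ a : resField x) = MvPolynomial.aeval (coords x) a) ∧ IsUnit (φ g) ∧
      (∀ b, b ∈ fractionSubalgebra φ g) ∧ (∀ j, c j ∈ B) ∧
      ∀ (L : Type u) [Field L] [Algebra k L] (f : MvPolynomial σ k →ₐ[k] L),
        (∀ a, MvPolynomial.aeval (coords x) a = 0 → f a = 0) → f g ≠ 0 →
          ∃ f' : B →ₐ[k] L, f'.comp φ = f := by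
  let p := (show PrimeSpectrum (MvPolynomial σ k) from x).asIdeal
  let ψ : MvPolynomial σ k →ₐ[k] resField x := MvPolynomial.aeval (coords x)
  obtain ⟨⟨d, hd⟩, hdc⟩ := IsLocalization.exist_integer_multiples_of_finite
    (nonZeroDivisors (MvPolynomial σ k ⧸ p)) c
  obtain ⟨g, rfl⟩ := Ideal.Quotient.mk_surjective d
  have hq : ∀ a : MvPolynomial σ k,
      algebraMap (MvPolynomial σ k ⧸ p) (resField x) (Ideal.Quotient.mk p a) = ψ a := by
    intro a
    change _ = MvPolynomial.aeval (coords x) a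
    rw [aeval_coords]
    rfl
  have hg : ψ g ≠ 0 := by
    rw [← hq, Ne, FaithfulSMul.algebraMap_eq_zero_iff]
    exact nonZeroDivisors.ne_zero hd
  let B := fractionSubalgebra ψ g
  let φ : MvPolynomial σ k →ₐ[k] B := ψ.codRestrict B (map_mem_fractionSubalgebra ψ g)
  have hu : IsUnit (φ g) := by
    refine IsUnit.of_mul_eq_one ⟨(ψ g)⁻¹, 1, 1, ?_⟩ ?_
    · rw [map_one, pow_one, inv_mul_cancel₀ hg]
    · exact Subtype.ext (mul_inv_cancel₀ hg)
  have hs : ∀ b, b ∈ fractionSubalgebra φ g := by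
    rintro ⟨b, a, n, h⟩
    exact ⟨a, n, Subtype.ext h⟩
  obtain ⟨π, hπ, hπφ⟩ := exists_surjective_away φ g hu hs
  have hft : Algebra.FiniteType k (Localization.Away g) :=
    Algebra.FiniteType.trans (S := MvPolynomial σ k) inferInstance
      (IsLocalization.finiteType_of_monoid_fg (Submonoid.powers g) _)
  refine ⟨B, φ, g, Algebra.FiniteType.of_surjective π hπ, fun a => rfl, hu, hs, fun j => ?_, ?_⟩
  · obtain ⟨r, hr⟩ := hdc j
    obtain ⟨a, rfl⟩ := Ideal.Quotient.mk_surjective r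
    refine ⟨a, 1, ?_⟩
    rw [← hq, hr, Algebra.smul_def, ← hq, pow_one, mul_comm]
  · intro L _ _ f hf hfg
    have hu' : ∀ y : Submonoid.powers g, IsUnit (f y) := by
      rintro ⟨_, n, rfl⟩
      simpa using (pow_ne_zero n hfg)
    let f₁ : Localization.Away g →ₐ[k] L := IsLocalization.liftAlgHom (M := Submonoid.powers g) hu'
    have hf₁ : ∀ a, f₁ (algebraMap _ _ a) = f a := fun a => IsLocalization.lift_eq _ a
    refine ⟨AlgHom.liftOfSurjective π hπ f₁ ?_, ?_⟩
    · intro z hz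
      obtain ⟨⟨a, s⟩, hz'⟩ := IsLocalization.surj (Submonoid.powers g) z
      have h1 : φ a = 0 := by
        rw [← hπφ, ← hz', map_mul, (show π z = 0 from hz), zero_mul]
      have h2 : f a = 0 := hf a (congrArg Subtype.val h1)
      have h3 : f₁ z * f s = 0 := by rw [← hf₁, ← map_mul, hz', hf₁, h2]
      exact (mul_eq_zero.mp h3).resolve_right (hu' s).ne_zero
    · ext s
      simp only [AlgHom.comp_apply]
      rw [← hπφ, AlgHom.liftOfSurjective_apply, hf₁]

theorem map_aeval {σ : Type} {A B : Type*} [CommRing A] [Algebra k A] [CommRing B] [Algebra k B]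
    (f : A →ₐ[k] B) (v : σ → A) (q : MvPolynomial σ k) :
    f (MvPolynomial.aeval v q) = MvPolynomial.aeval (f ∘ v) q :=
  MvPolynomial.comp_aeval_apply v f q

/-- A point of a locally closed set stays in this set under specializations which keep one
element invertible. -/
theorem exists_spread {σ : Type} {S : Set (affSpace k σ)} (hS : IsLocallyClosed S)
    {K : Type u} [Field K] [Algebra k K] {v : σ → K} (hv : pt v ∈ S) :
    ∃ c : K, c ≠ 0 ∧ ∀ (B : Subalgebra k K) (_ : c⁻¹ ∈ B) (v' : σ → B) (_ : ∀ s, (v' s : K) = v s)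
      (L : Type u) [Field L] [Algebra k L] (f : B →ₐ[k] L), pt (f ∘ v') ∈ S := by
  obtain ⟨U, Z, hU, hZ, rfl⟩ := hS
  obtain ⟨P, hP, hPU⟩ := exists_hypersurface (S := Uᶜ) hU.isClosed_compl (fun h => h hv.1)
  refine ⟨MvPolynomial.aeval v P, hP, fun B hB v' hv' L _ _ f => ⟨?_, ?_⟩⟩
  · have hval : ∀ q : MvPolynomial σ k, (MvPolynomial.aeval v' q : K) = MvPolynomial.aeval v q := by
      intro q
      have : v = B.val ∘ v' := funext fun s => (hv' s).symm
      rw [this, ← map_aeval]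
      rfl
    have hu : IsUnit (MvPolynomial.aeval v' P) := by
      refine IsUnit.of_mul_eq_one ⟨_, hB⟩ (Subtype.ext ?_)
      change (MvPolynomial.aeval v' P : K) * _ = 1
      rw [hval]
      exact mul_inv_cancel₀ hP
    by_contra hn
    have h0 : MvPolynomial.aeval (f ∘ v') P = 0 := pt_mem_hypersurface.mp (hPU hn)
    have h1 := (hu.map f).ne_zero
    rw [map_aeval] at h1
    exact h1 h0
  · refine hZ.closure_subset_iff.mpr (Set.singleton_subset_iff.mpr hv.2) (pt_mem_closure.mpr ?_)
    intro q hq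
    have hval : MvPolynomial.aeval v' q = 0 := by
      have : v = B.val ∘ v' := funext fun s => (hv' s).symm
      rw [this, ← map_aeval] at hq
      exact Subtype.ext hq
    have := congrArg f hval
    rw [map_aeval, map_zero] at this
    exact this

end Chart

section Bundle

variable {k : Type u} [Field k]

theorem comap_eq_pt {σ : Type} {B : Type u} [CommRing B] [Algebra k B]
    (φ : MvPolynomial σ k →ₐ[k] B) {L : Type u} [Field L] [Algebra k L] (f : B →ₐ[k] L) :
    (PrimeSpectrum.comap (φ : MvPolynomial σ k →+* B) (PrimeSpectrum.comap (f : B →+* L) ⊥) :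
      affSpace k σ) = pt fun s => f (φ (MvPolynomial.X s)) := by
  have h : MvPolynomial.aeval (fun s => f (φ (MvPolynomial.X s))) = f.comp φ := by
    ext s
    simp
  rw [pt, h]
  rfl

theorem comap_residueField {B : Type u} [CommRing B] [Algebra k B] (q : PrimeSpectrum B) :
    PrimeSpectrum.comap
      (IsScalarTower.toAlgHom k B q.asIdeal.ResidueField : B →+* q.asIdeal.ResidueField) ⊥ = q := by
  apply PrimeSpectrum.ext
  ext b
  exact Ideal.algebraMap_residueField_eq_zero

theorem range_comap_eq {σ : Type} {B : Type u} [CommRing B] [Algebra k B]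
    (φ : MvPolynomial σ k →ₐ[k] B) {S : Set (affSpace k σ)}
    (h₁ : ∀ (L : Type u) [Field L] [Algebra k L] (f : B →ₐ[k] L),
      pt (fun s => f (φ (MvPolynomial.X s))) ∈ S)
    (h₂ : ∀ x ∈ S, ∃ f : B →ₐ[k] resField x, ∀ s, f (φ (MvPolynomial.X s)) = coords x s) :
    Set.range (PrimeSpectrum.comap (φ : MvPolynomial σ k →+* B)) = S := by
  ext x
  constructor
  · rintro ⟨q, rfl⟩
    rw [← comap_residueField (k := k) q]
    have := h₁ _ (IsScalarTower.toAlgHom k B q.asIdeal.ResidueField)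
    rwa [← comap_eq_pt] at this
  · intro hx
    obtain ⟨f, hf⟩ := h₂ x hx
    refine ⟨PrimeSpectrum.comap (f : B →+* resField x) ⊥, ?_⟩
    refine (comap_eq_pt φ f).trans ?_
    rw [funext hf]
    exact pt_coords x

theorem pt_mem_closure_iff {σ : Type} {x : affSpace k σ} {L : Type u} [Field L] [Algebra k L]
    {w : σ → L} : pt (k := k) w ∈ closure {x} ↔
      ∀ p : MvPolynomial σ k, MvPolynomial.aeval (coords x) p = 0 → MvPolynomial.aeval w p = 0 := by
  rw [← pt_mem_closure, pt_coords]

theorem motive_additive {σ τ : Type} [Finite σ] [Finite τ] {C : Set (affSpace k τ)}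
    (hC : IsLocallyClosed C) {π : affSpace k τ → affSpace k σ} (hπ : Continuous π) (a : KVar k) :
    ScissorAdditive fun E => a * (subvariety (C ∩ π ⁻¹' E)).motive := by
  intro E Z hE hZ
  have h := motive_subvariety_add (hC.inter (hE.preimage hπ)) (hZ.preimage hπ)
  beta_reduce
  rw [← mul_add, h, Set.inter_assoc, ← Set.preimage_inter, Set.inter_sdiff_assoc,
    ← Set.preimage_sdiff]

theorem exists_generic {X : Type*} [TopologicalSpace X] {D : Set X} (hD : IsLocallyClosed D)
    (x : X) : (x ∈ D ∧ ∃ W, IsClosed W ∧ x ∉ W ∧ closure {x} \ W ⊆ D) ∨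
      (∃ W, IsClosed W ∧ x ∉ W ∧ D ∩ (closure {x} \ W) = ∅) := by
  obtain ⟨U, Z, hU, hZ, rfl⟩ := hD
  by_cases hxZ : x ∈ Z
  · have hsub : closure {x} ⊆ Z := hZ.closure_subset_iff.mpr (Set.singleton_subset_iff.mpr hxZ)
    by_cases hxU : x ∈ U
    · exact .inl ⟨⟨hxU, hxZ⟩, Uᶜ, hU.isClosed_compl, fun h => h hxU,
        fun y hy => ⟨Set.notMem_compl_iff.mp hy.2, hsub hy.1⟩⟩
    · have hsub' : closure {x} ⊆ Uᶜ :=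
        hU.isClosed_compl.closure_subset_iff.mpr (Set.singleton_subset_iff.mpr hxU)
      refine .inr ⟨∅, isClosed_empty, Set.notMem_empty _, ?_⟩
      ext y
      simp only [Set.mem_inter_iff, Set.mem_sdiff, Set.mem_empty_iff_false, iff_false]
      exact fun hy => hsub' hy.2.1 hy.1.1
  · refine .inr ⟨Z, hZ, hxZ, ?_⟩
    ext y
    simp only [Set.mem_inter_iff, Set.mem_sdiff, Set.mem_empty_iff_false, iff_false]
    exact fun hy => hy.2.2 hy.1.2

/-- A basis of a subspace of a coordinate space, together with a left inverse. -/
theorem exists_basis_leftInverse {ι : Type} [Fintype ι] {K : Type*} [Field K]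
    (W : Submodule K (ι → K)) {r : ℕ} (hr : Module.finrank K W = r) :
    ∃ (w : Fin r → ι → K) (M : Fin r → ι → K), (∀ j, w j ∈ W) ∧
      ∀ i j, ∑ s, M i s * w j s = if i = j then 1 else 0 := by
  classical
  let b := Module.finBasisOfFinrankEq K W hr
  let T : (Fin r → K) →ₗ[K] (ι → K) := W.subtype ∘ₗ b.equivFun.symm.toLinearMap
  have hT : LinearMap.ker T = ⊥ := by
    rw [LinearMap.ker_eq_bot]
    exact W.injective_subtype.comp b.equivFun.symm.injective
  obtain ⟨N, hN⟩ := T.exists_leftInverse_of_injective hT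
  refine ⟨fun j => b j, fun i s => N (Pi.single s 1) i, fun j => (b j).2, fun i j => ?_⟩
  have h1 : T (Pi.single j 1) = b j := by simp [T]
  have h2 : N (b j : ι → K) = Pi.single j 1 := by
    rw [← h1]
    exact LinearMap.congr_fun hN _
  have h3 : (b j : ι → K) = ∑ s, (b j : ι → K) s • Pi.single s (1 : K) := by
    ext s
    simp [Finset.sum_apply, Pi.single_apply]
  rw [h3, map_sum] at h2
  have h4 := congrFun h2 i
  simp only [map_smul, Finset.sum_apply, Pi.smul_apply, smul_eq_mul, Pi.single_apply] at h4
  rw [← h4]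
  exact Finset.sum_congr rfl fun s _ => mul_comm _ _

/-- Independent vectors in a subspace of the right dimension span it. -/
theorem exists_coeff_of_leftInverse {ι : Type} [Fintype ι] {K : Type*} [Field K]
    (W : Submodule K (ι → K)) {r : ℕ} (hr : Module.finrank K W = r) (w M : Fin r → ι → K)
    (hw : ∀ j, w j ∈ W) (hM : ∀ i j, ∑ s, M i s * w j s = if i = j then 1 else 0)
    {z : ι → K} (hz : z ∈ W) : ∃ c : Fin r → K, z = ∑ j, c j • w j := by
  classical
  let w' : Fin r → W := fun j => ⟨w j, hw j⟩
  have hli : LinearIndependent K w' := by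
    rw [Fintype.linearIndependent_iff]
    intro c hc i
    have h : ∑ j, c j • w j = 0 := by
      have := congrArg W.subtype hc
      simpa [w'] using this
    have h2 : ∑ s, M i s * (∑ j, c j • w j) s = c i := by
      simp only [Finset.sum_apply, Pi.smul_apply, smul_eq_mul, Finset.mul_sum]
      rw [Finset.sum_comm]
      calc ∑ j, ∑ s, M i s * (c j * w j s) = ∑ j, c j * ∑ s, M i s * w j s :=
            Finset.sum_congr rfl fun j _ => by
              rw [Finset.mul_sum]
              exact Finset.sum_congr rfl fun s _ => by ring
        _ = c i := by simp [hM]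
    rw [← h2, h]
    simp
  have hspan := hli.span_eq_top_of_card_eq_finrank' (by simp [hr])
  have hz' : (⟨z, hz⟩ : W) ∈ Submodule.span K (Set.range w') := by rw [hspan]; trivial
  obtain ⟨c, hc⟩ := (Submodule.mem_span_range_iff_exists_fun K).mp hz'
  refine ⟨c, ?_⟩
  have := congrArg W.subtype hc
  simpa [w'] using this.symm

end Bundle

section BundleTheorem

variable {k : Type u} [Field k]

/-- A family of linear subspaces of dimension `r` over a locally closed set `D`, as a locally
closed subset `C` of the product of `D` with a coordinate space. -/
structure IsLinearFamily {σ ι : Type} (D : Set (affSpace k σ)) (C : Set (affSpace k (σ ⊕ ι)))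
    (r : ℕ) : Prop where
  base : IsLocallyClosed D
  total : IsLocallyClosed C
  maps : ∀ x ∈ C, reindexMap k Sum.inl x ∈ D
  fiber : ∀ (K : Type u) [Field K] [Algebra k K] (y : σ → K), pt y ∈ D →
    ∃ W : Submodule K (ι → K), Module.finrank K W = r ∧
      ∀ w, pt (k := k) (Sum.elim y w) ∈ C ↔ w ∈ W

/-- Over a neighbourhood of the generic point of an irreducible closed subset of the base, a linear
family is trivial. -/
theorem IsLinearFamily.generic {σ ι : Type} [Finite σ] [Finite ι] {D : Set (affSpace k σ)}
    {C : Set (affSpace k (σ ⊕ ι))} {r : ℕ} (h : IsLinearFamily D C r) {x : affSpace k σ}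
    (hx : x ∈ D) : ∃ W : Set (affSpace k σ), IsClosed W ∧ x ∉ W ∧
      (subvariety (C ∩ reindexMap k Sum.inl ⁻¹' (closure {x} \ W))).motive
        = lefschetz k ^ r * (subvariety (D ∩ (closure {x} \ W))).motive := by
  classical
  have := Fintype.ofFinite ι
  have hy : pt (coords x) ∈ D := by rwa [pt_coords]
  obtain ⟨W, hr, hW⟩ := h.fiber _ (coords x) hy
  obtain ⟨w, M, hw, hM⟩ := exists_basis_leftInverse W hr
  obtain ⟨d, hd0, hd⟩ := exists_spread h.base hy
  have hC : ∀ j, ∃ c : resField x, c ≠ 0 ∧ _ := fun j => exists_spread h.total ((hW (w j)).mpr (hw j))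
  choose c hc0 hc using hC
  obtain ⟨B, φ, g, hft, hφ, hgu, hfr, hcB, hlift⟩ := exists_chart x
    (Sum.elim (fun q : Fin r × ι => w q.1 q.2) (Sum.elim (fun q : Fin r × ι => M q.1 q.2)
      (Sum.elim (fun j : Fin r => (c j)⁻¹) fun _ : Unit => d⁻¹)))
  have hwB : ∀ j i, w j i ∈ B := fun j i => hcB (.inl (j, i))
  have hMB : ∀ j i, M j i ∈ B := fun j i => hcB (.inr (.inl (j, i)))
  have hcB' : ∀ j, (c j)⁻¹ ∈ B := fun j => hcB (.inr (.inr (.inl j)))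
  have hdB : d⁻¹ ∈ B := hcB (.inr (.inr (.inr ())))
  let w' : Fin r → ι → B := fun j i => ⟨w j i, hwB j i⟩
  let M' : Fin r → ι → B := fun j i => ⟨M j i, hMB j i⟩
  have hM' : ∀ i j, ∑ s, M' i s * w' j s = if i = j then 1 else 0 := by
    intro i j
    apply Subtype.ext
    have := hM i j
    push_cast [M', w']
    rw [this]
    split_ifs <;> rfl
  let y' : σ → B := fun s => φ (MvPolynomial.X s)
  have hy' : ∀ s, (y' s : resField x) = coords x s := fun s => by simp [y', hφ]
  -- the points of the chart
  have hbase : ∀ (L : Type u) [Field L] [Algebra k L] (f : B →ₐ[k] L), pt (k := k) (f ∘ y') ∈ D :=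
    fun L _ _ f => hd B hdB y' hy' L f
  have hvec : ∀ (L : Type u) [Field L] [Algebra k L] (f : B →ₐ[k] L) (j : Fin r),
      pt (k := k) (Sum.elim (f ∘ y') (f ∘ w' j)) ∈ C := by
    intro L _ _ f j
    have := hc j B (hcB' j) (Sum.elim y' (w' j)) (by rintro (s | i) <;> simp [hy', w']) L f
    rwa [Sum.comp_elim] at this
  have hopen : ∀ (L : Type u) [Field L] [Algebra k L] (f : B →ₐ[k] L),
      pt (k := k) (f ∘ y') ∈ closure {x} \ hypersurface g := by
    intro L _ _ f
    have hfy : ∀ a : MvPolynomial σ k, MvPolynomial.aeval (f ∘ y') a = f (φ a) := by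
      intro a
      rw [← map_aeval]
      congr 1
      have : MvPolynomial.aeval y' = φ := by
        ext s
        simp [y']
      rw [this]
    constructor
    · rw [pt_mem_closure_iff]
      intro a ha
      rw [hfy, Subtype.ext (a1 := φ a) (a2 := 0) ((hφ a).trans ha), map_zero]
    · rw [pt_mem_hypersurface, hfy]
      exact (hgu.map f).ne_zero
  have hpoint : ∀ (L : Type u) [Field L] [Algebra k L] (y : σ → L),
      pt (k := k) y ∈ closure {x} \ hypersurface g → ∃ f : B →ₐ[k] L, f ∘ y' = y := by
    intro L _ _ y hy
    obtain ⟨f, hf⟩ := hlift L (MvPolynomial.aeval y)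
      (pt_mem_closure_iff.mp hy.1) hy.2
    refine ⟨f, funext fun s => ?_⟩
    have := AlgHom.congr_fun hf (MvPolynomial.X s)
    simpa [y'] using this
  have hD : (subvariety (D ∩ (closure {x} \ hypersurface g))).motive = motiveSpec k B := by
    refine motive_subvariety_eq_motiveSpec φ g hgu hfr (range_comap_eq φ ?_ ?_)
    · exact fun L _ _ f => ⟨hbase L f, hopen L f⟩
    · rintro z ⟨-, hz⟩
      rw [← pt_coords z] at hz
      obtain ⟨f, hf⟩ := hpoint _ _ hz
      exact ⟨f, fun s => congrFun hf s⟩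
  let v : σ ⊕ ι → MvPolynomial (Fin r) B :=
    Sum.elim (fun s => MvPolynomial.C (y' s))
      fun i => ∑ j, MvPolynomial.C (w' j i) * MvPolynomial.X j
  let Φ : MvPolynomial (σ ⊕ ι) k →ₐ[k] MvPolynomial (Fin r) B := MvPolynomial.aeval v
  let G : MvPolynomial (σ ⊕ ι) k := MvPolynomial.rename Sum.inl g
  have hΦ : ∀ a : MvPolynomial σ k, Φ (MvPolynomial.rename Sum.inl a) = MvPolynomial.C (φ a) := by
    intro a
    have : (Φ.comp (MvPolynomial.rename Sum.inl)) =
        (IsScalarTower.toAlgHom k B (MvPolynomial (Fin r) B)).comp φ := by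
      ext s : 1
      simp [Φ, v, y']
    exact AlgHom.congr_fun this a
  have hGu : IsUnit (Φ G) := by
    rw [hΦ]
    exact hgu.map _
  have hFr : ∀ b, b ∈ fractionSubalgebra Φ G := by
    have hCb : ∀ b : B, (MvPolynomial.C b : MvPolynomial (Fin r) B) ∈ fractionSubalgebra Φ G := by
      intro b
      obtain ⟨a, n, hab⟩ := hfr b
      refine ⟨MvPolynomial.rename Sum.inl a, n, ?_⟩
      rw [hΦ, hΦ, hab, map_mul, map_pow]
    intro b
    induction b using MvPolynomial.induction_on with
    | C b => exact hCb b
    | add p q hp hq => exact add_mem hp hq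
    | mul_X p j hp =>
      refine mul_mem hp ?_
      have hX : (MvPolynomial.X j : MvPolynomial (Fin r) B) =
          ∑ i, MvPolynomial.C (M' j i) * Φ (MvPolynomial.X (Sum.inr i)) := by
        simp only [Φ, MvPolynomial.aeval_X, v, Sum.elim_inr, Finset.mul_sum]
        rw [Finset.sum_comm]
        simp only [← mul_assoc, ← map_mul]
        simp only [← Finset.sum_mul, ← map_sum, hM']
        simp
      rw [hX]
      exact sum_mem fun i _ => mul_mem (hCb _) (map_mem_fractionSubalgebra _ _ _)
  have hCm : (subvariety (C ∩ reindexMap k Sum.inl ⁻¹' (closure {x} \ hypersurface g))).motive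
      = motiveSpec k (MvPolynomial (Fin r) B) := by
    refine motive_subvariety_eq_motiveSpec Φ G hGu hFr (range_comap_eq Φ ?_ ?_)
    · intro L _ _ F
      let f : B →ₐ[k] L := F.comp (IsScalarTower.toAlgHom k B (MvPolynomial (Fin r) B))
      obtain ⟨WL, -, hWL⟩ := h.fiber L (f ∘ y') (hbase L f)
      have hv : (fun s => F (Φ (MvPolynomial.X s))) =
          Sum.elim (f ∘ y') (∑ j, F (MvPolynomial.X j) • (f ∘ w' j)) := by
        ext (s | i)
        · simp [Φ, v, f, MvPolynomial.algebraMap_eq]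
        · simp [Φ, v, f, MvPolynomial.algebraMap_eq, mul_comm]
      rw [hv]
      refine ⟨(hWL _).mpr (sum_mem fun j _ => WL.smul_mem _ ((hWL _).mp (hvec L f j))), ?_⟩
      rw [Set.mem_preimage, reindexMap_pt, Sum.elim_comp_inl]
      exact hopen L f
    · rintro z ⟨hzC, hz⟩
      have hz' := hz
      rw [Set.mem_preimage, ← pt_coords z, reindexMap_pt] at hz'
      obtain ⟨f, hf⟩ := hpoint _ _ hz'
      obtain ⟨WL, hrL, hWL⟩ := h.fiber _ (f ∘ y') (hbase _ f)
      have hmem : coords z ∘ Sum.inr ∈ WL := by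
        rw [← hWL, hf, Sum.elim_comp_inl_inr, pt_coords]
        exact hzC
      have hML : ∀ i j, ∑ s, (f ∘ M' i) s * (f ∘ w' j) s = if i = j then 1 else 0 := by
        intro i j
        have := congrArg f (hM' i j)
        rw [map_sum] at this
        simp only [map_mul] at this
        rw [show (∑ s, (f ∘ M' i) s * (f ∘ w' j) s) = ∑ s, f (M' i s) * f (w' j s) from rfl, this]
        split_ifs <;> simp
      obtain ⟨a, ha⟩ := exists_coeff_of_leftInverse WL hrL (fun j => f ∘ w' j) (fun i => f ∘ M' i)
        (fun j => (hWL _).mp (hvec _ f j)) hML hmem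
      let F : MvPolynomial (Fin r) B →ₐ[k] resField z := MvPolynomial.aevalTower f a
      refine ⟨F, ?_⟩
      rintro (s | i)
      · simpa [Φ, v, F] using congrFun hf s
      · have := congrFun ha i
        simp only [Function.comp_apply, Finset.sum_apply, Pi.smul_apply, smul_eq_mul] at this
        simp [Φ, v, F, this, mul_comm]
  refine ⟨hypersurface g, isClosed_hypersurface g, ?_, ?_⟩
  · intro hxg
    have hxg' : pt (coords x) ∈ hypersurface g := by rwa [pt_coords]
    exact hgu.ne_zero (Subtype.ext ((hφ g).trans hxg'))
  · rw [hD, hCm, motiveSpec_mvPolynomial]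

theorem IsLinearFamily.motive_eq {σ ι : Type} [Finite σ] [Finite ι] {D : Set (affSpace k σ)}
    {C : Set (affSpace k (σ ⊕ ι))} {r : ℕ} (h : IsLinearFamily D C r) :
    (subvariety C).motive = lefschetz k ^ r * (subvariety D).motive := by
  have hπ := continuous_reindexMap (k := k) (Sum.inl : σ → σ ⊕ ι)
  have hF := motive_additive h.total hπ 1
  have hG := motive_additive h.base (continuous_id) (lefschetz k ^ r)
  have hnoeth : TopologicalSpace.NoetherianSpace (affSpace k σ) := inferInstance
  have key := hF.eq_of_generic hG (fun x => ?_) isClosed_univ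
  · simpa using key
  rcases exists_generic h.base x with ⟨hx, -⟩ | ⟨W, hW, hxW, he⟩
  · obtain ⟨W, hW, hxW, he⟩ := h.generic hx
    exact ⟨W, hW, hxW, by simpa using he⟩
  · refine ⟨W, hW, hxW, ?_⟩
    have he' : C ∩ reindexMap k Sum.inl ⁻¹' (closure {x} \ W) = ∅ := by
      rw [Set.eq_empty_iff_forall_notMem]
      exact fun z hz => (Set.eq_empty_iff_forall_notMem.mp he) _ ⟨h.maps z hz.1, hz.2⟩
    rw [he', Set.preimage_id, he, motive_subvariety_empty, motive_subvariety_empty, mul_zero,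
      mul_zero]

end BundleTheorem

/-! ### Rank and minors -/

section Minors

variable {m n K : Type*} [Fintype m] [Fintype n] [Field K]

theorem exists_linearIndependent_rows (M : Matrix m n K) {r : ℕ} (hr : r ≤ M.rank) :
    ∃ f : Fin r → m, LinearIndependent K (M.submatrix f id).row := by
  obtain ⟨f, hf, -, hli⟩ := Submodule.exists_fun_fin_finrank_span_eq K (Set.range M.row)
  choose g hg using hf
  have hr' : r ≤ Module.finrank K (Submodule.span K (Set.range M.row)) := by
    rwa [← M.rank_eq_finrank_span_row]
  refine ⟨fun i => g (Fin.castLE hr' i), ?_⟩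
  have h : (M.submatrix (fun i => g (Fin.castLE hr' i)) id).row = f ∘ Fin.castLE hr' := by
    funext i
    exact hg _
  rw [h]
  exact hli.comp _ (Fin.castLE_injective hr')

theorem rank_le_iff_minors (M : Matrix m n K) (r : ℕ) :
    M.rank ≤ r ↔ ∀ (f : Fin (r + 1) → m) (g : Fin (r + 1) → n), (M.submatrix f g).det = 0 := by
  constructor
  · intro h f g
    by_contra hdet
    have h1 := (M.submatrix f g).rank_of_det_ne_zero hdet
    have h2 := M.rank_submatrix_le f g
    rw [h1, Fintype.card_fin] at h2
    omega
  · intro h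
    by_contra hr
    obtain ⟨f, hf⟩ := exists_linearIndependent_rows M (r := r + 1) (by omega)
    have hN : (M.submatrix f id).transpose.rank = r + 1 := by
      rw [Matrix.rank_transpose, hf.rank_matrix, Fintype.card_fin]
    obtain ⟨g, hg⟩ := exists_linearIndependent_rows (M.submatrix f id).transpose hN.ge
    have hu := Matrix.linearIndependent_rows_iff_isUnit.mp hg
    have hdet := ((Matrix.isUnit_iff_isUnit_det _).mp hu).ne_zero
    rw [Matrix.transpose_submatrix, Matrix.submatrix_submatrix, ← Matrix.det_transpose] at hdet
    exact hdet (h f g)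

theorem rank_map_field {L : Type*} [Field L] (f : K →+* L) (M : Matrix m n K) :
    (M.map f).rank = M.rank := by
  have h : ∀ r, (M.map f).rank ≤ r ↔ M.rank ≤ r := by
    intro r
    rw [rank_le_iff_minors, rank_le_iff_minors]
    refine forall₂_congr fun a b => ?_
    rw [Matrix.submatrix_map]
    change (f.mapMatrix _).det = 0 ↔ _
    rw [← RingHom.map_det, map_eq_zero]
  exact le_antisymm ((h _).mpr le_rfl) ((h _).mp le_rfl)

end Minors

/-! ### Changing coordinates -/

section Reindex

variable {k : Type u} [Field k] {σ τ : Type}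

theorem reindexMap_comp {ρ : Type} (f : σ → τ) (g : τ → ρ) (x : affSpace k ρ) :
    reindexMap k f (reindexMap k g x) = reindexMap k (g ∘ f) x := by
  rw [← pt_coords x, reindexMap_pt, reindexMap_pt, reindexMap_pt]
  rfl

theorem reindexMap_id (x : affSpace k σ) : reindexMap k id x = x := by
  rw [← pt_coords x, reindexMap_pt]
  rfl

theorem motive_reindexMap_preimage [Finite σ] [Finite τ] (e : σ ≃ τ) {S : Set (affSpace k σ)}
    (hS : IsLocallyClosed S) :
    (subvariety (reindexMap k e ⁻¹' S)).motive = (subvariety S).motive := by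
  have hS' : IsLocallyClosed (reindexMap k e ⁻¹' S) := hS.preimage (continuous_reindexMap _)
  have hsurj : Function.Surjective (reindexMap k e) := fun x =>
    ⟨reindexMap k e.symm x, by rw [reindexMap_comp, e.symm_comp_self, reindexMap_id]⟩
  let φ : MvPolynomial σ k →+* MvPolynomial τ k := (MvPolynomial.rename e).toRingHom
  have hiso : IsIso (CommRingCat.ofHom φ) :=
    inferInstanceAs (IsIso (MvPolynomial.renameEquiv k e).toRingEquiv.toCommRingCatIso.hom)
  let i : affSpace k τ ⟶ affSpace k σ := Spec.map (CommRingCat.ofHom φ)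
  have hi : i ≫ affSpaceHom k σ = affSpaceHom k τ := by
    rw [← Spec.map_comp, ← CommRingCat.ofHom_comp]
    congr 2
    exact (MvPolynomial.rename (R := k) e).comp_algebraMap
  have hred : IsReduced (reducedSubscheme (reindexMap k e ⁻¹' S)) := isReduced_reducedSubscheme _
  symm
  rw [motive_subvariety (reindexMap k e ⁻¹' S)]
  refine motive_subvariety_eq _ (reducedSubschemeι _ ≫ i) ?_ ?_
  · rw [Category.assoc, hi]
  · rw [Scheme.Hom.comp_base, TopCat.coe_comp, Set.range_comp, range_reducedSubschemeι _ hS']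
    exact Set.image_preimage_eq S hsurj

end Reindex

/-! ### Loci of pairs of matrices -/

section Locus

variable {k : Type u} [Field k] {d : ℕ}

/-- The first matrix of a family of coordinates. -/
def fstMat {R : Type*} (v : PairIndex d → R) : Matrix (Fin d) (Fin d) R :=
  Matrix.of fun i j => v (Sum.inl (i, j))

/-- The second matrix of a family of coordinates. -/
def sndMat {R : Type*} (v : PairIndex d → R) : Matrix (Fin d) (Fin d) R :=
  Matrix.of fun i j => v (Sum.inr (i, j))

theorem exists_resField_hom {σ : Type} {K : Type u} [Field K] [Algebra k K] (v : σ → K) :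
    ∃ f : resField (pt (k := k) v) →+* K, f ∘ coords (pt v) = v := by
  let p : PrimeSpectrum (MvPolynomial σ k) := pt v
  let φ : MvPolynomial σ k →+* K := (MvPolynomial.aeval (R := k) v).toRingHom
  have h1 : p.asIdeal ≤ RingHom.ker φ := fun a ha => ha
  have h2 : p.asIdeal.primeCompl ≤ (IsUnit.submonoid K).comap φ :=
    fun a ha => isUnit_iff_ne_zero.mpr ha
  refine ⟨Ideal.ResidueField.lift p.asIdeal φ h1 h2, ?_⟩
  funext s
  change Ideal.ResidueField.lift p.asIdeal φ h1 h2 (algebraMap _ _ (MvPolynomial.X s)) = _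
  rw [Ideal.ResidueField.lift_algebraMap]
  exact MvPolynomial.aeval_X v s

/-- A property of pairs of matrices which does not depend on the field of coefficients. -/
def FieldInvariant (P : ∀ {K : Type u} [Field K],
    Matrix (Fin d) (Fin d) K → Matrix (Fin d) (Fin d) K → Prop) : Prop :=
  ∀ {K L : Type u} [Field K] [Field L] (f : K →+* L) (X Y : Matrix (Fin d) (Fin d) K),
    P (X.map f) (Y.map f) ↔ P X Y

theorem pt_mem_locus {P : ∀ {K : Type u} [Field K],
    Matrix (Fin d) (Fin d) K → Matrix (Fin d) (Fin d) K → Prop} (hP : FieldInvariant P)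
    {K : Type u} [Field K] [Algebra k K] (v : PairIndex d → K) :
    pt v ∈ locus k d P ↔ P (fstMat v) (sndMat v) := by
  obtain ⟨f, hf⟩ := exists_resField_hom (k := k) v
  have h := hP f (fstMat (coords (pt (k := k) v))) (sndMat (coords (pt (k := k) v)))
  have h1 : (fstMat (coords (pt (k := k) v))).map f = fstMat v := by
    conv_rhs => rw [← hf]
    rfl
  have h2 : (sndMat (coords (pt (k := k) v))).map f = sndMat v := by
    conv_rhs => rw [← hf]
    rfl
  rw [h1, h2] at h
  exact h.symm

theorem isClosed_setOf_algebraMap_eq_zero {σ : Type} (p : MvPolynomial σ k) :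
    IsClosed {x : affSpace k σ | algebraMap _ (resField x) p = 0} := by
  have h : {x : affSpace k σ | algebraMap _ (resField x) p = 0} = hypersurface p := by
    ext x
    exact Ideal.algebraMap_residueField_eq_zero
  rw [h]
  exact isClosed_hypersurface p

theorem isClosed_setOf_map_eq_zero {σ : Type} {m n : Type} (M : Matrix m n (MvPolynomial σ k)) :
    IsClosed {x : affSpace k σ | M.map (algebraMap _ (resField x)) = 0} := by
  have h : {x : affSpace k σ | M.map (algebraMap _ (resField x)) = 0} =
      ⋂ (i : m) (j : n), {x : affSpace k σ | algebraMap _ (resField x) (M i j) = 0} := by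
    ext x
    simp only [Set.mem_ofPred_eq, Set.mem_iInter, ← Matrix.ext_iff]
    rfl
  rw [h]
  exact isClosed_iInter fun i => isClosed_iInter fun j => isClosed_setOf_algebraMap_eq_zero _

theorem isClosed_setOf_rank_le {σ : Type} {m n : Type} [Fintype m] [Fintype n]
    (M : Matrix m n (MvPolynomial σ k)) (r : ℕ) :
    IsClosed {x : affSpace k σ | (M.map (algebraMap _ (resField x))).rank ≤ r} := by
  have h : {x : affSpace k σ | (M.map (algebraMap _ (resField x))).rank ≤ r} =
      ⋂ (f : Fin (r + 1) → m) (g : Fin (r + 1) → n),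
        {x : affSpace k σ | algebraMap _ (resField x) (M.submatrix f g).det = 0} := by
    ext x
    simp only [Set.mem_ofPred_eq, Set.mem_iInter, rank_le_iff_minors]
    refine forall₂_congr fun a b => ?_
    rw [Matrix.submatrix_map, RingHom.map_det]
    rfl
  rw [h]
  exact isClosed_iInter fun i => isClosed_iInter fun j => isClosed_setOf_algebraMap_eq_zero _

end Locus

/-! ### The matrix factorization -/

section LinearAlgebra

open Matrix

variable {d : ℕ} {K : Type u} [Field K] (X Y : Matrix (Fin d) (Fin d) K)

/-- The block matrix `[[X, Y²], [Y, X]]`, the partner of `matA X Y`. -/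
def matB : Matrix (Fin d ⊕ Fin d) (Fin d ⊕ Fin d) K := fromBlocks X (Y ^ 2) Y X

/-- The block matrix `[[0, Y], [1, 0]]`, a square root of `Y`. -/
def matJ : Matrix (Fin d ⊕ Fin d) (Fin d ⊕ Fin d) K := fromBlocks 0 Y 1 0

/-- The block matrix `[[0, 1], [0, 0]]`. -/
def matR (d : ℕ) (K : Type u) [Field K] : Matrix (Fin d ⊕ Fin d) (Fin d ⊕ Fin d) K :=
  fromBlocks 0 1 0 0

/-- The block matrix `[[1, 0], [0, -1]]`. -/
def matS (d : ℕ) (K : Type u) [Field K] : Matrix (Fin d ⊕ Fin d) (Fin d ⊕ Fin d) K :=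
  fromBlocks 1 0 0 (-1)

theorem matS_mul_matS : matS d K * matS d K = 1 := by
  simp [matS, fromBlocks_multiply]

theorem matB_mul_matS : matB X Y * matS d K = matS d K * matA X Y := by
  simp [matS, matA, matB, fromBlocks_multiply]

theorem matJ_mul_matR : matJ Y * matR d K + matR d K * matJ Y = 1 := by
  simp [matJ, matR, fromBlocks_multiply, fromBlocks_add]

theorem matJ_mul_matJ :
    matJ Y * matJ Y = matR d K * matB X Y - matA X Y * matR d K := by
  simp [matJ, matR, matA, matB, fromBlocks_multiply, sub_eq_add_neg, fromBlocks_neg,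
    fromBlocks_add]

theorem matR_mul_matA : matR d K * matA X Y =
    matA X Y * matR d K + matJ Y * fromBlocks 0 Y (-1) 0 := by
  simp [matJ, matR, matA, fromBlocks_multiply, fromBlocks_add]

theorem matB_mul_matR : matB X Y * matR d K =
    matR d K * matB X Y + fromBlocks 0 (-Y) 1 0 * matJ Y := by
  simp [matJ, matR, matB, fromBlocks_multiply, fromBlocks_add]

variable {X Y} (h : CuspEquations X Y)

include h

theorem matB_mul_matA : matB X Y * matA X Y = 0 := by
  obtain ⟨h₁, h₂⟩ := h
  have h₃ : Y ^ 2 * X = X * Y ^ 2 := by rw [pow_two, mul_assoc, ← h₂, ← mul_assoc, ← h₂, mul_assoc]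
  rw [matA, matB, fromBlocks_multiply]
  simp only [mul_neg, h₃]
  rw [← pow_two, h₁, ← pow_succ, ← pow_succ', h₂]
  simp

theorem matJ_mul_matA : matJ Y * matA X Y = matA X Y * matJ Y := by
  obtain ⟨h₁, h₂⟩ := h
  simp [matA, matJ, fromBlocks_multiply, h₂, pow_two]

theorem matJ_mul_matB : matJ Y * matB X Y = matB X Y * matJ Y := by
  obtain ⟨h₁, h₂⟩ := h
  simp [matB, matJ, fromBlocks_multiply, h₂, pow_two]

theorem matB_mul_aux : matB X Y * fromBlocks 0 Y (-1) 0 =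
    -(fromBlocks 0 (-Y) 1 0 * matA X Y) := by
  obtain ⟨h₁, h₂⟩ := h
  simp [matA, matB, fromBlocks_multiply, fromBlocks_neg, h₂, pow_two]

omit h in
theorem rank_matB : (matB X Y).rank = (matA X Y).rank := by
  have hS : IsUnit (matS d K).det := by
    rw [← isUnit_iff_isUnit_det]
    exact IsUnit.of_mul_eq_one _ matS_mul_matS
  rw [← rank_mul_eq_left_of_isUnit_det (matS d K) (matB X Y) hS, matB_mul_matS,
    rank_mul_eq_right_of_isUnit_det _ _ hS]

end LinearAlgebra

section Submodules

open Matrix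

theorem finrank_map_add_finrank_inf_ker {K V W : Type*} [Field K] [AddCommGroup V] [Module K V]
    [FiniteDimensional K V] [AddCommGroup W] [Module K W] (f : V →ₗ[K] W) (P : Submodule K V) :
    Module.finrank K (P.map f) + Module.finrank K (P ⊓ LinearMap.ker f : Submodule K V)
      = Module.finrank K P := by
  rw [← LinearMap.finrank_range_add_finrank_ker (f.domRestrict P), LinearMap.range_domRestrict,
    LinearMap.ker_domRestrict]
  congr 1
  rw [← Submodule.map_comap_subtype]
  exact (LinearEquiv.finrank_eq (Submodule.equivSubtypeMap P _)).symm

variable {d : ℕ} {K : Type u} [Field K] (X Y : Matrix (Fin d) (Fin d) K)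

/-- The kernel of `matB X Y`. -/
abbrev kerB : Submodule K (Fin d ⊕ Fin d → K) := LinearMap.ker (matB X Y).mulVecLin

/-- The image of `matA X Y`. -/
abbrev imA : Submodule K (Fin d ⊕ Fin d → K) := LinearMap.range (matA X Y).mulVecLin

/-- The vectors in the kernel of `matB X Y` which `matJ Y` maps to the image of `matA X Y`. -/
def midSubmodule : Submodule K (Fin d ⊕ Fin d → K) :=
  kerB X Y ⊓ (imA X Y).comap (matJ Y).mulVecLin

variable {X Y}

theorem finrank_kerB : Module.finrank K (kerB X Y) + (matA X Y).rank = 2 * d := by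
  have h := LinearMap.finrank_range_add_finrank_ker (matB X Y).mulVecLin
  change (matB X Y).rank + Module.finrank K (kerB X Y) = _ at h
  rw [Module.finrank_fintype_fun_eq_card, Fintype.card_sum, Fintype.card_fin, rank_matB] at h
  omega

theorem matJ_sq_mem {w : Fin d ⊕ Fin d → K} (hw : w ∈ kerB X Y) :
    matJ Y *ᵥ (matJ Y *ᵥ w) ∈ imA X Y := by
  have hw' : matB X Y *ᵥ w = 0 := hw
  rw [mulVec_mulVec, matJ_mul_matJ X Y, sub_mulVec, ← mulVec_mulVec, hw', mulVec_zero, zero_sub]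
  refine neg_mem ⟨matR d K *ᵥ w, ?_⟩
  rw [mulVecLin_apply, mulVec_mulVec]

variable (h : CuspEquations X Y)

include h

theorem matJ_mem_kerB {w : Fin d ⊕ Fin d → K} (hw : w ∈ kerB X Y) :
    matJ Y *ᵥ w ∈ kerB X Y := by
  have hw' : matB X Y *ᵥ w = 0 := hw
  change matB X Y *ᵥ _ = 0
  rw [mulVec_mulVec, ← matJ_mul_matB h, ← mulVec_mulVec, hw', mulVec_zero]

theorem matJ_mem_imA {w : Fin d ⊕ Fin d → K} (hw : w ∈ imA X Y) : matJ Y *ᵥ w ∈ imA X Y := by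
  obtain ⟨u, rfl⟩ := hw
  refine ⟨matJ Y *ᵥ u, ?_⟩
  simp only [mulVecLin_apply, mulVec_mulVec, matJ_mul_matA h]

theorem imA_le_kerB : imA X Y ≤ kerB X Y := by
  rintro _ ⟨u, rfl⟩
  change matB X Y *ᵥ (matA X Y *ᵥ u) = 0
  rw [mulVec_mulVec, matB_mul_matA h, zero_mulVec]

theorem imA_le_midSubmodule : imA X Y ≤ midSubmodule X Y :=
  fun _ hw => ⟨imA_le_kerB h hw, matJ_mem_imA h hw⟩

theorem exists_of_mem_midSubmodule {w : Fin d ⊕ Fin d → K} (hw : w ∈ midSubmodule X Y) :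
    ∃ z ∈ kerB X Y, w - matJ Y *ᵥ z ∈ imA X Y := by
  obtain ⟨hN : matB X Y *ᵥ w = 0, u, hu⟩ := hw
  simp only [mulVecLin_apply] at hu
  refine ⟨matR d K *ᵥ w + (fromBlocks 0 Y (-1) 0) *ᵥ u, ?_, matR d K *ᵥ u, ?_⟩
  · change matB X Y *ᵥ _ = 0
    rw [mulVec_add, mulVec_mulVec, mulVec_mulVec, matB_mul_matR, matB_mul_aux h, add_mulVec,
      ← mulVec_mulVec, ← mulVec_mulVec, hN, neg_mulVec, ← mulVec_mulVec, hu, mulVec_zero, zero_add,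
      add_neg_cancel]
  · have h1 : w = matJ Y *ᵥ (matR d K *ᵥ w) + matR d K *ᵥ (matJ Y *ᵥ w) := by
      rw [mulVec_mulVec, mulVec_mulVec, ← add_mulVec, matJ_mul_matR, one_mulVec]
    have h2 : matR d K *ᵥ (matA X Y *ᵥ u) =
        matA X Y *ᵥ (matR d K *ᵥ u) + matJ Y *ᵥ (fromBlocks 0 Y (-1) 0 *ᵥ u) := by
      simp only [mulVec_mulVec, ← add_mulVec, matR_mul_matA]
    rw [← hu, h2] at h1
    rw [mulVecLin_apply, mulVec_add, eq_sub_iff_add_eq]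
    refine Eq.trans ?_ h1.symm
    abel

theorem finrank_midSubmodule : Module.finrank K (midSubmodule X Y) = d := by
  let g := (imA X Y).mkQ ∘ₗ (matJ Y).mulVecLin
  have h1 := finrank_map_add_finrank_inf_ker g (kerB X Y)
  have h2 := finrank_map_add_finrank_inf_ker (imA X Y).mkQ (midSubmodule X Y)
  have h3 : kerB X Y ⊓ LinearMap.ker g = midSubmodule X Y := by
    rw [LinearMap.ker_comp, Submodule.ker_mkQ]
    rfl
  have h4 : midSubmodule X Y ⊓ LinearMap.ker (imA X Y).mkQ = imA X Y := by
    rw [Submodule.ker_mkQ, inf_eq_right]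
    exact imA_le_midSubmodule h
  have h5 : (kerB X Y).map g = (midSubmodule X Y).map (imA X Y).mkQ := by
    ext q
    constructor
    · rintro ⟨w, hw, rfl⟩
      exact ⟨matJ Y *ᵥ w, ⟨matJ_mem_kerB h hw, matJ_sq_mem hw⟩, rfl⟩
    · rintro ⟨w, hw, rfl⟩
      obtain ⟨z, hz, hwz⟩ := exists_of_mem_midSubmodule h hw
      refine ⟨z, hz, ?_⟩
      exact ((Submodule.Quotient.eq _).mpr hwz).symm
  have h6 := finrank_kerB (X := X) (Y := Y)
  have h7 : Module.finrank K (imA X Y) = (matA X Y).rank := rfl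
  rw [h3, h5] at h1
  rw [h4] at h2
  omega

omit h in
theorem finrank_sup_span {V : Type*} [AddCommGroup V] [Module K V] [FiniteDimensional K V]
    (I : Submodule K V) (s : Set V) :
    Module.finrank K (I ⊔ Submodule.span K s : Submodule K V) =
      Module.finrank K (Submodule.span K (I.mkQ '' s)) + Module.finrank K I := by
  rw [← finrank_map_add_finrank_inf_ker I.mkQ (I ⊔ Submodule.span K s), Submodule.ker_mkQ,
    inf_eq_right.mpr le_sup_left, Submodule.map_sup, Submodule.mkQ_map_self, bot_sup_eq,
    Submodule.map_span]

theorem finrank_sup_span_pair {w : Fin d ⊕ Fin d → K} (hw : w ∈ kerB X Y)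
    {r : ℕ} (hr : Module.finrank K
      (imA X Y ⊔ Submodule.span K {w, matJ Y *ᵥ w} : Submodule K (Fin d ⊕ Fin d → K)) = r) :
    (r ≤ (matA X Y).rank ↔ w ∈ imA X Y) ∧ (r ≤ (matA X Y).rank + 1 ↔ w ∈ midSubmodule X Y) ∧
      r ≤ (matA X Y).rank + 2 := by
  have h7 : Module.finrank K (imA X Y) = (matA X Y).rank := rfl
  rw [finrank_sup_span, Set.image_pair, h7] at hr
  have hmid : w ∈ midSubmodule X Y ↔ matJ Y *ᵥ w ∈ imA X Y := ⟨fun hh => hh.2, fun hh => ⟨hw, hh⟩⟩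
  have hq : ∀ v, (imA X Y).mkQ v = 0 ↔ v ∈ imA X Y := fun v => Submodule.Quotient.mk_eq_zero _
  by_cases h0 : w ∈ imA X Y
  · rw [(hq _).mpr h0, (hq _).mpr (matJ_mem_imA h h0)] at hr
    rw [Set.pair_eq_singleton, Submodule.span_zero_singleton, finrank_bot] at hr
    exact ⟨⟨fun _ => h0, fun _ => by omega⟩, ⟨fun _ => hmid.mpr (matJ_mem_imA h h0), fun _ => by omega⟩, by omega⟩
  · by_cases h1 : matJ Y *ᵥ w ∈ imA X Y
    · rw [(hq _).mpr h1, Set.pair_comm, Submodule.span_insert_zero,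
        finrank_span_singleton (fun hh => h0 ((hq _).mp hh))] at hr
      exact ⟨⟨fun _ => by omega, fun hh => absurd hh h0⟩, ⟨fun _ => hmid.mpr h1, fun _ => by omega⟩,
        by omega⟩
    · have hli : LinearIndependent K ![(imA X Y).mkQ w, (imA X Y).mkQ (matJ Y *ᵥ w)] := by
        rw [LinearIndependent.pair_iff]
        intro s t hst
        rw [← map_smul, ← map_smul, ← map_add, hq] at hst
        have hs : s = 0 := by
          by_contra hs
          apply h1
          have h2 := matJ_mem_imA h hst
          rw [mulVec_add, mulVec_smul, mulVec_smul] at h2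
          have h3 := (imA X Y).sub_mem h2 ((imA X Y).smul_mem t (matJ_sq_mem hw))
          rw [add_sub_cancel_right] at h3
          exact ((imA X Y).smul_mem_iff hs).mp h3
        subst hs
        refine ⟨rfl, ?_⟩
        by_contra ht
        apply h1
        rw [zero_smul, zero_add] at hst
        exact ((imA X Y).smul_mem_iff ht).mp hst
      have hc := finrank_span_eq_card hli
      rw [Fintype.card_fin, Matrix.range_cons_cons_empty] at hc
      rw [hc] at hr
      exact ⟨⟨fun _ => by omega, fun hh => absurd hh h0⟩,
        ⟨fun _ => by omega, fun hh => absurd (hmid.mp hh) h1⟩, by omega⟩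

end Submodules

/-! ### Adding a column -/

section Column

open Matrix

variable {d : ℕ} {K : Type u} [Field K]

/-- The matrix without its last row and last column. -/
abbrev subMat (M : Matrix (Fin (d + 1)) (Fin (d + 1)) K) : Matrix (Fin d) (Fin d) K :=
  M.submatrix Fin.castSucc Fin.castSucc

/-- The last column without its last entry. -/
def lastCol (M : Matrix (Fin (d + 1)) (Fin (d + 1)) K) : Fin d → K :=
  fun i => M i.castSucc (Fin.last d)

/-- The last row vanishes. -/
def LastRowZero (M : Matrix (Fin (d + 1)) (Fin (d + 1)) K) : Prop := ∀ j, M (Fin.last d) j = 0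

variable {M N : Matrix (Fin (d + 1)) (Fin (d + 1)) K}

theorem LastRowZero.mul (hM : LastRowZero M) : LastRowZero (M * N) := by
  intro j
  simp [mul_apply, hM _]

theorem subMat_mul (hN : LastRowZero N) : subMat (M * N) = subMat M * subMat N := by
  ext i j
  simp [mul_apply, Fin.sum_univ_castSucc, hN _]

theorem lastCol_mul (hN : LastRowZero N) : lastCol (M * N) = subMat M *ᵥ lastCol N := by
  ext i
  simp [lastCol, mul_apply, Fin.sum_univ_castSucc, hN _, mulVec, dotProduct]

theorem eq_iff_of_lastRowZero (hM : LastRowZero M) (hN : LastRowZero N) :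
    M = N ↔ subMat M = subMat N ∧ lastCol M = lastCol N := by
  refine ⟨fun h => by rw [h]; exact ⟨rfl, rfl⟩, fun ⟨h₁, h₂⟩ => ?_⟩
  ext i j
  refine Fin.lastCases ((hM j).trans (hN j).symm) (fun i => ?_) i
  exact Fin.lastCases (congrFun h₂ i) (fun j => congrFun (congrFun h₁ i) j) j

theorem strictlyUpper_succ_iff :
    StrictlyUpper M ↔ LastRowZero M ∧ StrictlyUpper (subMat M) := by
  refine ⟨fun h => ⟨fun j => h _ _ (Fin.le_last j), fun i j hij => h _ _ hij⟩, fun ⟨h₁, h₂⟩ => ?_⟩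
  intro i
  refine Fin.lastCases (fun j _ => h₁ j) (fun i => ?_) i
  intro j
  refine Fin.lastCases (fun hj => ?_) (fun j hj => h₂ i j hj) j
  exact absurd hj (not_le.mpr (Fin.castSucc_lt_last i))

/-- The pairs of matrices forming the variety `stairV`. -/
def IsStair {d : ℕ} {K : Type u} [Field K] (X Y : Matrix (Fin d) (Fin d) K) : Prop :=
  StrictlyUpper X ∧ StrictlyUpper Y ∧ CuspEquations X Y

/-- The vector in the kernel of `matB` defined by the last columns. -/
def lastVec (X Y : Matrix (Fin (d + 1)) (Fin (d + 1)) K) : Fin d ⊕ Fin d → K :=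
  Sum.elim (lastCol X) (-lastCol Y)

variable {X Y : Matrix (Fin (d + 1)) (Fin (d + 1)) K}

theorem cuspEquations_succ_iff (hX : LastRowZero X) (hY : LastRowZero Y) :
    CuspEquations X Y ↔ CuspEquations (subMat X) (subMat Y) ∧
      lastVec X Y ∈ kerB (subMat X) (subMat Y) := by
  have hw : lastVec X Y ∈ kerB (subMat X) (subMat Y) ↔
      subMat X *ᵥ lastCol X = (subMat Y * subMat Y) *ᵥ lastCol Y ∧
        subMat X *ᵥ lastCol Y = subMat Y *ᵥ lastCol X := by
    change matB _ _ *ᵥ _ = 0 ↔ _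
    rw [matB, lastVec, fromBlocks_mulVec, ← Sum.elim_zero_zero, Sum.elim_eq_iff]
    simp only [Sum.elim_comp_inl, Sum.elim_comp_inr, mulVec_neg, ← sub_eq_add_neg, sub_eq_zero,
      pow_two]
    exact and_congr_right fun _ => eq_comm
  have hY2 : subMat (Y * Y) = subMat Y * subMat Y := subMat_mul hY
  rw [hw, CuspEquations, CuspEquations, pow_two, pow_succ, pow_two,
    eq_iff_of_lastRowZero hX.mul (hY.mul.mul), eq_iff_of_lastRowZero hX.mul hY.mul, subMat_mul hX,
    subMat_mul hX, subMat_mul hY, subMat_mul hY, subMat_mul hY, lastCol_mul hX, lastCol_mul hY, lastCol_mul hX,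
    lastCol_mul hY, hY2, pow_two, pow_succ, pow_two]
  tauto

theorem isStair_succ_iff : IsStair X Y ↔ (LastRowZero X ∧ LastRowZero Y) ∧
    IsStair (subMat X) (subMat Y) ∧ lastVec X Y ∈ kerB (subMat X) (subMat Y) := by
  rw [IsStair, IsStair, strictlyUpper_succ_iff, strictlyUpper_succ_iff]
  constructor
  · rintro ⟨⟨h₁, h₂⟩, ⟨h₃, h₄⟩, h₅⟩
    rw [cuspEquations_succ_iff h₁ h₃] at h₅
    exact ⟨⟨h₁, h₃⟩, ⟨h₂, h₄, h₅.1⟩, h₅.2⟩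
  · rintro ⟨⟨h₁, h₃⟩, ⟨h₂, h₄, h₅⟩, h₆⟩
    exact ⟨⟨h₁, h₂⟩, ⟨h₃, h₄⟩, (cuspEquations_succ_iff h₁ h₃).mpr ⟨h₅, h₆⟩⟩

/-- Restriction of vectors to the first coordinates of both blocks. -/
def restrictVec (d : ℕ) (K : Type u) [Field K] :
    (Fin (d + 1) ⊕ Fin (d + 1) → K) →ₗ[K] (Fin d ⊕ Fin d → K) :=
  LinearMap.funLeft K K (Sum.map Fin.castSucc Fin.castSucc)

theorem matA_mulVec_castSucc (hY : LastRowZero Y)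
    (v : Fin (d + 1) ⊕ Fin (d + 1) → K) :
    restrictVec d K (matA X Y *ᵥ v) = matA (subMat X) (subMat Y) *ᵥ restrictVec d K v
      + v (Sum.inl (Fin.last d)) • lastVec X Y
      + v (Sum.inr (Fin.last d)) • (matJ (subMat Y) *ᵥ lastVec X Y) := by
  have hY2 : subMat (Y * Y) = subMat Y * subMat Y := subMat_mul hY
  have hY2' : ∀ i j, (Y * Y) (Fin.castSucc i) (Fin.castSucc j) = (subMat Y * subMat Y) i j :=
    fun i j => congrFun (congrFun hY2 i) j
  have hc : ∀ i, (Y * Y) (Fin.castSucc i) (Fin.last d) = (subMat Y *ᵥ lastCol Y) i :=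
    fun i => congrFun (lastCol_mul hY) i
  have key : ∀ (M : Matrix (Fin (d + 1)) (Fin (d + 1)) K) (p : Fin (d + 1) → K) (i : Fin d),
      (M *ᵥ p) i.castSucc = (subMat M *ᵥ (p ∘ Fin.castSucc)) i + p (Fin.last d) * lastCol M i := by
    intro M p i
    simp [mulVec, dotProduct, Fin.sum_univ_castSucc, lastCol, mul_comm]
  have hJ : matJ (subMat Y) *ᵥ lastVec X Y = Sum.elim (-(subMat Y *ᵥ lastCol Y)) (lastCol X) := by
    rw [matJ, lastVec, fromBlocks_mulVec]
    simp [mulVec_neg]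
  rw [hJ]
  funext s
  rcases s with i | i
  · change (matA X Y *ᵥ v) (Sum.inl i.castSucc) = _
    rw [matA, matA, fromBlocks_mulVec, fromBlocks_mulVec]
    simp only [Sum.elim_inl, Pi.add_apply, Pi.smul_apply, smul_eq_mul, neg_mulVec, Pi.neg_apply,
      pow_two, key, lastVec]
    rw [hY2, show lastCol (Y * Y) i = _ from hc i]
    have e1 : (v ∘ Sum.inl) ∘ Fin.castSucc = restrictVec d K v ∘ Sum.inl := rfl
    have e2 : (v ∘ Sum.inr) ∘ Fin.castSucc = restrictVec d K v ∘ Sum.inr := rfl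
    rw [e1, e2]
    simp only [Function.comp_apply]
    ring
  · change (matA X Y *ᵥ v) (Sum.inr i.castSucc) = _
    rw [matA, matA, fromBlocks_mulVec, fromBlocks_mulVec]
    simp only [Sum.elim_inr, Pi.add_apply, Pi.smul_apply, smul_eq_mul, neg_mulVec, Pi.neg_apply,
      key, lastVec]
    have e1 : (v ∘ Sum.inl) ∘ Fin.castSucc = restrictVec d K v ∘ Sum.inl := rfl
    have e2 : (v ∘ Sum.inr) ∘ Fin.castSucc = restrictVec d K v ∘ Sum.inr := rfl
    rw [e1, e2]
    simp only [Function.comp_apply]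
    ring

theorem matA_mulVec_last (hX : LastRowZero X) (hY : LastRowZero Y)
    (v : Fin (d + 1) ⊕ Fin (d + 1) → K) :
    (matA X Y *ᵥ v) (Sum.inl (Fin.last d)) = 0 ∧ (matA X Y *ᵥ v) (Sum.inr (Fin.last d)) = 0 := by
  have key : ∀ {M : Matrix (Fin (d + 1)) (Fin (d + 1)) K} (p : Fin (d + 1) → K),
      LastRowZero M → (M *ᵥ p) (Fin.last d) = 0 := by
    intro M p hM
    simp [mulVec, dotProduct, hM _]
  rw [matA, fromBlocks_mulVec]
  simp only [Sum.elim_inl, Sum.elim_inr, Pi.add_apply, neg_mulVec, Pi.neg_apply, pow_two,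
    key _ hX, key _ hY, key _ (hY.mul (N := Y))]
  simp

theorem rank_matA_succ (hX : LastRowZero X) (hY : LastRowZero Y) :
    Module.finrank K (imA (subMat X) (subMat Y) ⊔
      Submodule.span K {lastVec X Y, matJ (subMat Y) *ᵥ lastVec X Y} :
        Submodule K (Fin d ⊕ Fin d → K)) = (matA X Y).rank := by
  have hmap : (imA X Y).map (restrictVec d K) = imA (subMat X) (subMat Y) ⊔
      Submodule.span K {lastVec X Y, matJ (subMat Y) *ᵥ lastVec X Y} := by
    ext z
    rw [Submodule.mem_sup]
    simp only [Submodule.mem_span_pair]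
    constructor
    · rintro ⟨_, ⟨v, rfl⟩, rfl⟩
      refine ⟨_, ⟨restrictVec d K v, rfl⟩, _,
        ⟨v (Sum.inl (Fin.last d)), v (Sum.inr (Fin.last d)), rfl⟩, ?_⟩
      rw [mulVecLin_apply, mulVecLin_apply, matA_mulVec_castSucc hY, add_assoc]
    · rintro ⟨_, ⟨p, rfl⟩, _, ⟨s, t, rfl⟩, rfl⟩
      let v : Fin (d + 1) ⊕ Fin (d + 1) → K := Sum.elim
        (Fin.snoc (α := fun _ => K) (p ∘ Sum.inl) s) (Fin.snoc (α := fun _ => K) (p ∘ Sum.inr) t)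
      have hv : restrictVec d K v = p := by
        funext i
        rcases i with i | i <;> simp [v, restrictVec]
      refine ⟨_, ⟨v, rfl⟩, ?_⟩
      rw [mulVecLin_apply, mulVecLin_apply, matA_mulVec_castSucc hY, hv, add_assoc]
      simp [v]
  have h := finrank_map_add_finrank_inf_ker (restrictVec d K) (imA X Y)
  have hbot : imA X Y ⊓ LinearMap.ker (restrictVec d K) = ⊥ := by
    rw [eq_bot_iff]
    rintro _ ⟨⟨v, rfl⟩, hv⟩
    rw [Submodule.mem_bot]
    have h0 := matA_mulVec_last hX hY v
    funext s
    rcases s with i | i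
    · exact Fin.lastCases h0.1 (fun i => congrFun hv (Sum.inl i)) i
    · exact Fin.lastCases h0.2 (fun i => congrFun hv (Sum.inr i)) i
  rw [hbot, hmap, finrank_bot, add_zero] at h
  exact h

end Column

section Strata

open Matrix

variable {k : Type u} [Field k] {d : ℕ}

theorem fieldInvariant_cuspEquations :
    FieldInvariant (d := d) fun {K} [Field K] X Y => CuspEquations X Y := by
  intro K L _ _ f X Y
  have hinj : Function.Injective (f.mapMatrix (m := Fin d)) := Matrix.map_injective f.injective
  change f.mapMatrix X ^ 2 = f.mapMatrix Y ^ 3 ∧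
    f.mapMatrix X * f.mapMatrix Y = f.mapMatrix Y * f.mapMatrix X ↔ _
  rw [← map_pow, ← map_pow, ← map_mul, ← map_mul, hinj.eq_iff, hinj.eq_iff]
  rfl

theorem strictlyUpper_map {K L : Type u} [Field K] [Field L] (f : K →+* L)
    (X : Matrix (Fin d) (Fin d) K) : StrictlyUpper (X.map f) ↔ StrictlyUpper X :=
  forall₃_congr fun _ _ _ => map_eq_zero f

theorem fieldInvariant_isStair : FieldInvariant (d := d) fun {K} [Field K] X Y => IsStair X Y :=
  fun f X Y => and_congr (strictlyUpper_map f X)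
    (and_congr (strictlyUpper_map f Y) (fieldInvariant_cuspEquations f X Y))

theorem pt_mem_stairV {K : Type u} [Field K] [Algebra k K] (v : PairIndex d → K) :
    pt v ∈ stairV k d ↔ IsStair (fstMat v) (sndMat v) :=
  pt_mem_locus (P := fun {K} [Field K] X Y => IsStair X Y) fieldInvariant_isStair v

theorem mem_stairV_iff (x : PairSpace k d) :
    x ∈ stairV k d ↔ IsStair (fstMat (coords x)) (sndMat (coords x)) :=
  Iff.rfl

theorem matA_map {K L : Type u} [Field K] [Field L] (f : K →+* L)
    (X Y : Matrix (Fin d) (Fin d) K) : matA (X.map f) (Y.map f) = (matA X Y).map f := by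
  have h : (Y.map f) ^ 2 = (Y ^ 2).map f := (map_pow f.mapMatrix Y 2).symm
  rw [matA, matA, fromBlocks_map, h]
  congr 1 <;> ext i j <;> simp

theorem isClosed_cuspEquations : IsClosed {x : PairSpace k d |
    CuspEquations (fstMat (coords x)) (sndMat (coords x))} := by
  let X := fstMat (MvPolynomial.X : PairIndex d → MvPolynomial (PairIndex d) k)
  let Y := sndMat (MvPolynomial.X : PairIndex d → MvPolynomial (PairIndex d) k)
  have h : {x : PairSpace k d | CuspEquations (fstMat (coords x)) (sndMat (coords x))} =
      {x | (X ^ 2 - Y ^ 3).map (algebraMap _ (resField x)) = 0} ∩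
        {x | (X * Y - Y * X).map (algebraMap _ (resField x)) = 0} := by
    ext x
    let φ := (algebraMap (MvPolynomial (PairIndex d) k) (resField x)).mapMatrix (m := Fin d)
    change φ X ^ 2 = φ Y ^ 3 ∧ φ X * φ Y = φ Y * φ X ↔
      φ (X ^ 2 - Y ^ 3) = 0 ∧ φ (X * Y - Y * X) = 0
    rw [map_sub, map_sub, map_pow, map_pow, map_mul, map_mul, sub_eq_zero, sub_eq_zero]
  rw [h]
  exact (isClosed_setOf_map_eq_zero _).inter (isClosed_setOf_map_eq_zero _)

theorem isClosed_fstMat_eq_zero (R : Fin d → Fin d → Prop) :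
    IsClosed {x : PairSpace k d | ∀ i j, R i j → fstMat (coords x) i j = 0} := by
  simp only [Set.ofPred_forall]
  exact isClosed_iInter fun i => isClosed_iInter fun j => isClosed_iInter fun _ =>
    isClosed_setOf_algebraMap_eq_zero _

theorem isClosed_sndMat_eq_zero (R : Fin d → Fin d → Prop) :
    IsClosed {x : PairSpace k d | ∀ i j, R i j → sndMat (coords x) i j = 0} := by
  simp only [Set.ofPred_forall]
  exact isClosed_iInter fun i => isClosed_iInter fun j => isClosed_iInter fun _ =>
    isClosed_setOf_algebraMap_eq_zero _

theorem isClosed_stairV : IsClosed (stairV k d) :=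
  (isClosed_fstMat_eq_zero fun i j => j ≤ i).inter
    ((isClosed_sndMat_eq_zero fun i j => j ≤ i).inter isClosed_cuspEquations)

/-- The rank of `matA` at a point of affine space. -/
noncomputable def rk (x : PairSpace k d) : ℕ :=
  (matA (fstMat (coords x)) (sndMat (coords x))).rank

/-- The rank of `matA` for the submatrices without the last row and column. -/
noncomputable def rkSub (x : PairSpace k (d + 1)) : ℕ :=
  (matA (subMat (fstMat (coords x))) (subMat (sndMat (coords x)))).rank

theorem rk_pt {K : Type u} [Field K] [Algebra k K] (v : PairIndex d → K) :
    rk (pt (k := k) v) = (matA (fstMat v) (sndMat v)).rank := by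
  obtain ⟨f, hf⟩ := exists_resField_hom (k := k) v
  rw [rk, ← rank_map_field f, ← matA_map]
  conv_rhs => rw [← hf]
  rfl

theorem rkSub_pt {K : Type u} [Field K] [Algebra k K] (v : PairIndex (d + 1) → K) :
    rkSub (pt (k := k) v) = (matA (subMat (fstMat v)) (subMat (sndMat v))).rank := by
  obtain ⟨f, hf⟩ := exists_resField_hom (k := k) v
  rw [rkSub, ← rank_map_field f, ← matA_map]
  conv_rhs => rw [← hf]
  rfl

theorem isClosed_rank_matA_le {σ : Type} (X Y : Matrix (Fin d) (Fin d) (MvPolynomial σ k)) (r : ℕ) :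
    IsClosed {x : affSpace k σ | (matA (X.map (algebraMap _ (resField x)))
      (Y.map (algebraMap _ (resField x)))).rank ≤ r} := by
  convert! isClosed_setOf_rank_le (fromBlocks X (-(Y ^ 2)) (-Y) X) r using 4 with x
  have h : (Y.map (algebraMap _ (resField x))) ^ 2 = (Y ^ 2).map (algebraMap _ (resField x)) :=
    (map_pow (algebraMap (MvPolynomial σ k) (resField x)).mapMatrix Y 2).symm
  rw [matA, fromBlocks_map, h]
  congr 2 <;> ext i j <;> simp

theorem isClosed_rk_le (r : ℕ) : IsClosed {x : PairSpace k d | rk x ≤ r} :=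
  isClosed_rank_matA_le (fstMat MvPolynomial.X) (sndMat MvPolynomial.X) r

theorem isClosed_rkSub_le (r : ℕ) : IsClosed {x : PairSpace k (d + 1) | rkSub x ≤ r} :=
  isClosed_rank_matA_le ((fstMat MvPolynomial.X).submatrix Fin.castSucc Fin.castSucc)
    ((sndMat MvPolynomial.X).submatrix Fin.castSucc Fin.castSucc) r

theorem isClosed_lt_of_le {X : Type*} [TopologicalSpace X] {ρ : X → ℕ}
    (h : ∀ r, IsClosed {x | ρ x ≤ r}) (n : ℕ) : IsClosed {x | ρ x < n} := by
  cases n with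
  | zero => simp
  | succ n => simpa only [Nat.lt_succ_iff] using h n

theorem isLocallyClosed_eq_of_le {X : Type*} [TopologicalSpace X] {ρ : X → ℕ}
    (h : ∀ r, IsClosed {x | ρ x ≤ r}) (n : ℕ) : IsLocallyClosed {x | ρ x = n} := by
  have he : {x | ρ x = n} = {x | ρ x < n}ᶜ ∩ {x | ρ x ≤ n} := by
    ext x
    simp only [Set.mem_inter_iff, Set.mem_compl_iff, Set.mem_ofPred_eq]
    omega
  rw [he]
  exact ⟨_, _, (isClosed_lt_of_le h n).isOpen_compl, h n, rfl⟩

theorem motive_eq_sum_fibers {σ : Type} [Finite σ] {ρ : affSpace k σ → ℕ}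
    (h : ∀ r, IsClosed {x | ρ x ≤ r}) (N : ℕ) {S : Set (affSpace k σ)} (hS : IsLocallyClosed S)
    (hN : ∀ x ∈ S, ρ x < N) :
    (subvariety S).motive = ∑ n ∈ Finset.range N, (subvariety (S ∩ {x | ρ x = n})).motive := by
  induction N generalizing S with
  | zero =>
    have : S = ∅ := Set.eq_empty_iff_forall_notMem.mpr fun x hx => Nat.not_lt_zero _ (hN x hx)
    rw [this, motive_subvariety_empty, Finset.range_zero, Finset.sum_empty]
  | succ N ih =>
    rw [Finset.sum_range_succ, motive_subvariety_add hS (isClosed_lt_of_le h N),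
      ih (hS.inter (isClosed_lt_of_le h N).isLocallyClosed) fun x hx => hx.2]
    congr 1
    · refine Finset.sum_congr rfl fun n hn => ?_
      congr 2
      ext x
      simp only [Set.mem_inter_iff, Set.mem_ofPred_eq]
      have := Finset.mem_range.mp hn
      constructor
      · exact fun hx => ⟨hx.1.1, hx.2⟩
      · exact fun hx => ⟨⟨hx.1, by omega⟩, hx.2⟩
    · congr 2
      ext x
      simp only [Set.mem_inter_iff, Set.mem_ofPred_eq, Set.mem_sdiff]
      refine and_congr_right fun hx => ?_
      have := hN x hx
      omega

/-- The points of `stairV` at which `matA` has rank `n`. -/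
def rankStratum (k : Type u) [Field k] (d n : ℕ) : Set (PairSpace k d) :=
  stairV k d ∩ {x | rk x = n}

/-- The points of `stairV` at which `matA` has rank at most `n + r`, and rank `n` before the last
row and column are added. -/
def rankPiece (k : Type u) [Field k] (d n r : ℕ) : Set (PairSpace k (d + 1)) :=
  (stairV k (d + 1) ∩ {x | rkSub x = n}) ∩ {x | rk x ≤ n + r}

theorem isLocallyClosed_rankStratum (n : ℕ) : IsLocallyClosed (rankStratum k d n) :=
  isClosed_stairV.isLocallyClosed.inter (isLocallyClosed_eq_of_le isClosed_rk_le n)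

theorem isLocallyClosed_rankPiece (n r : ℕ) : IsLocallyClosed (rankPiece k d n r) :=
  (isClosed_stairV.isLocallyClosed.inter (isLocallyClosed_eq_of_le isClosed_rkSub_le n)).inter
    (isClosed_rk_le _).isLocallyClosed

end Strata

section Family

open Matrix

variable {k : Type u} [Field k] {d : ℕ}

/-- The coordinates in the last columns and rows of a pair of matrices. -/
abbrev FiberIndex (d : ℕ) : Type := (Fin d ⊕ Fin d) ⊕ (Fin (d + 1) ⊕ Fin (d + 1))

/-- The inclusions of the coordinates of the submatrices, the last columns and the last rows. -/
def joinIndex (d : ℕ) : PairIndex d ⊕ FiberIndex d → PairIndex (d + 1) :=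
  Sum.elim (Sum.map (Prod.map Fin.castSucc Fin.castSucc) (Prod.map Fin.castSucc Fin.castSucc))
    (Sum.elim (Sum.map (fun i => (i.castSucc, Fin.last d)) (fun i => (i.castSucc, Fin.last d)))
      (Sum.map (fun j => (Fin.last d, j)) (fun j => (Fin.last d, j))))

theorem bijective_joinIndex (d : ℕ) : Function.Bijective (joinIndex d) := by
  constructor
  · have h : ∀ i : Fin d, Fin.last d ≠ i.castSucc := fun i => (Fin.castSucc_lt_last i).ne'
    have h' : ∀ i : Fin d, i.castSucc ≠ Fin.last d := fun i => (Fin.castSucc_lt_last i).ne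
    rintro ((⟨i, j⟩ | ⟨i, j⟩) | ((i | i) | (i | i))) ((⟨i', j'⟩ | ⟨i', j'⟩) | ((i' | i') | (i' | i')))
      hij <;> simp_all [joinIndex]
  · rintro (⟨i, j⟩ | ⟨i, j⟩)
    · refine Fin.lastCases ⟨.inr (.inr (.inl j)), rfl⟩ (fun i => ?_) i
      exact Fin.lastCases ⟨.inr (.inl (.inl i)), rfl⟩ (fun j => ⟨.inl (.inl (i, j)), rfl⟩) j
    · refine Fin.lastCases ⟨.inr (.inr (.inr j)), rfl⟩ (fun i => ?_) i
      exact Fin.lastCases ⟨.inr (.inl (.inr i)), rfl⟩ (fun j => ⟨.inl (.inr (i, j)), rfl⟩) j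

/-- The coordinates of a pair of matrices, split into submatrices, last columns and last rows. -/
noncomputable def splitIndex (d : ℕ) : PairIndex (d + 1) ≃ PairIndex d ⊕ FiberIndex d :=
  (Equiv.ofBijective _ (bijective_joinIndex d)).symm

theorem splitIndex_joinIndex (s : PairIndex d ⊕ FiberIndex d) :
    splitIndex d (joinIndex d s) = s :=
  (Equiv.ofBijective _ (bijective_joinIndex d)).symm_apply_apply s

section Coordinates

variable {K : Type u} (y : PairIndex d → K) (w : FiberIndex d → K)

theorem subMat_fstMat : subMat (fstMat (Sum.elim y w ∘ splitIndex d)) = fstMat y := by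
  ext i j
  exact congrArg (Sum.elim y w) (splitIndex_joinIndex (.inl (.inl (i, j))))

theorem subMat_sndMat : subMat (sndMat (Sum.elim y w ∘ splitIndex d)) = sndMat y := by
  ext i j
  exact congrArg (Sum.elim y w) (splitIndex_joinIndex (.inl (.inr (i, j))))

variable [Field K]

theorem lastRowZero_iff : (LastRowZero (fstMat (Sum.elim y w ∘ splitIndex d)) ∧
    LastRowZero (sndMat (Sum.elim y w ∘ splitIndex d))) ↔ w ∘ Sum.inr = 0 := by
  have h₁ : ∀ j, fstMat (Sum.elim y w ∘ splitIndex d) (Fin.last d) j = w (.inr (.inl j)) :=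
    fun j => congrArg (Sum.elim y w) (splitIndex_joinIndex (.inr (.inr (.inl j))))
  have h₂ : ∀ j, sndMat (Sum.elim y w ∘ splitIndex d) (Fin.last d) j = w (.inr (.inr j)) :=
    fun j => congrArg (Sum.elim y w) (splitIndex_joinIndex (.inr (.inr (.inr j))))
  simp only [LastRowZero, h₁, h₂, funext_iff, Sum.forall]
  rfl

theorem lastVec_eq : lastVec (fstMat (Sum.elim y w ∘ splitIndex d))
    (sndMat (Sum.elim y w ∘ splitIndex d)) = matS d K *ᵥ (w ∘ Sum.inl) := by
  have h₁ : ∀ i, lastCol (fstMat (Sum.elim y w ∘ splitIndex d)) i = w (.inl (.inl i)) :=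
    fun i => congrArg (Sum.elim y w) (splitIndex_joinIndex (.inr (.inl (.inl i))))
  have h₂ : ∀ i, lastCol (sndMat (Sum.elim y w ∘ splitIndex d)) i = w (.inl (.inr i)) :=
    fun i => congrArg (Sum.elim y w) (splitIndex_joinIndex (.inr (.inl (.inr i))))
  rw [lastVec, matS, fromBlocks_mulVec, funext h₁, funext h₂]
  funext i
  rcases i with i | i <;> simp [neg_mulVec]

end Coordinates

/-- The last columns and rows which define a given vector. -/
noncomputable def fiberMap (d : ℕ) (K : Type u) [Field K] :
    (Fin d ⊕ Fin d → K) →ₗ[K] (FiberIndex d → K) where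
  toFun z := Sum.elim (matS d K *ᵥ z) 0
  map_add' z z' := by
    rw [mulVec_add]
    funext s
    rcases s with s | s <;> simp
  map_smul' c z := by
    rw [mulVec_smul]
    funext s
    rcases s with s | s <;> simp

theorem matS_mulVec_matS {K : Type u} [Field K] (z : Fin d ⊕ Fin d → K) :
    matS d K *ᵥ (matS d K *ᵥ z) = z := by
  rw [mulVec_mulVec, matS_mul_matS, one_mulVec]

theorem mem_map_fiberMap {K : Type u} [Field K] (U : Submodule K (Fin d ⊕ Fin d → K))
    (w : FiberIndex d → K) :
    w ∈ U.map (fiberMap d K) ↔ w ∘ Sum.inr = 0 ∧ matS d K *ᵥ (w ∘ Sum.inl) ∈ U := by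
  constructor
  · rintro ⟨z, hz, rfl⟩
    refine ⟨rfl, ?_⟩
    change matS d K *ᵥ (matS d K *ᵥ z) ∈ U
    rwa [matS_mulVec_matS]
  · rintro ⟨h₁, h₂⟩
    refine ⟨_, h₂, ?_⟩
    change Sum.elim (matS d K *ᵥ (matS d K *ᵥ _)) 0 = w
    rw [matS_mulVec_matS, ← h₁, Sum.elim_comp_inl_inr]

theorem injective_fiberMap {K : Type u} [Field K] : Function.Injective (fiberMap d K) := by
  intro z z' h
  have h' : matS d K *ᵥ z = matS d K *ᵥ z' := congrArg (fun u => u ∘ Sum.inl) h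
  rw [← matS_mulVec_matS z, h', matS_mulVec_matS]

theorem isLinearFamily_rankPiece (n r c : ℕ)
    (hU : ∀ (K : Type u) [Field K] (X Y : Matrix (Fin d) (Fin d) K), CuspEquations X Y →
      (matA X Y).rank = n → ∃ U : Submodule K (Fin d ⊕ Fin d → K), U ≤ kerB X Y ∧
        Module.finrank K U = c ∧ ∀ w ∈ kerB X Y, Module.finrank K
          (imA X Y ⊔ Submodule.span K {w, matJ Y *ᵥ w} : Submodule K (Fin d ⊕ Fin d → K)) ≤ n + r ↔
            w ∈ U) :
    IsLinearFamily (rankStratum k d n) (reindexMap k (splitIndex d) ⁻¹' rankPiece k d n r) c := by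
  have hiff : ∀ (K : Type u) [Field K] [Algebra k K] (y : PairIndex d → K) (w : FiberIndex d → K),
      pt (k := k) (Sum.elim y w) ∈ reindexMap k (splitIndex d) ⁻¹' rankPiece k d n r ↔
        (IsStair (fstMat (Sum.elim y w ∘ splitIndex d)) (sndMat (Sum.elim y w ∘ splitIndex d)) ∧
          (matA (fstMat y) (sndMat y)).rank = n) ∧
          (matA (fstMat (Sum.elim y w ∘ splitIndex d))
            (sndMat (Sum.elim y w ∘ splitIndex d))).rank ≤ n + r := by
    intro K _ _ y w
    rw [Set.mem_preimage, reindexMap_pt, rankPiece, Set.mem_inter_iff, Set.mem_inter_iff,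
      pt_mem_stairV, Set.mem_ofPred_eq, Set.mem_ofPred_eq, rkSub_pt, rk_pt, subMat_fstMat,
      subMat_sndMat]
  have hbase : ∀ (K : Type u) [Field K] [Algebra k K] (y : PairIndex d → K),
      pt (k := k) y ∈ rankStratum k d n ↔
        IsStair (fstMat y) (sndMat y) ∧ (matA (fstMat y) (sndMat y)).rank = n := by
    intro K _ _ y
    rw [rankStratum, Set.mem_inter_iff, pt_mem_stairV, Set.mem_ofPred_eq, rk_pt]
  refine ⟨isLocallyClosed_rankStratum n,
    (isLocallyClosed_rankPiece n r).preimage (continuous_reindexMap _), ?_, ?_⟩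
  · intro x hx
    rw [← pt_coords x, ← Sum.elim_comp_inl_inr (coords x), hiff, isStair_succ_iff, subMat_fstMat,
      subMat_sndMat] at hx
    rw [← pt_coords x, reindexMap_pt, hbase]
    exact ⟨hx.1.1.2.1, hx.1.2⟩
  · intro K _ _ y hy
    rw [hbase] at hy
    obtain ⟨U, hle, hc, hw⟩ := hU K _ _ hy.1.2.2 hy.2
    refine ⟨U.map (fiberMap d K), ?_, fun w => ?_⟩
    · rw [← hc]
      exact (Submodule.equivMapOfInjective _ injective_fiberMap U).symm.finrank_eq
    · rw [hiff, isStair_succ_iff, subMat_fstMat, subMat_sndMat, mem_map_fiberMap, lastVec_eq,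
        lastRowZero_iff]
      constructor
      · rintro ⟨⟨⟨hrow, -, hk⟩, -⟩, hr⟩
        obtain ⟨hX, hY⟩ := (lastRowZero_iff y w).mpr hrow
        rw [← rank_matA_succ hX hY, subMat_fstMat, subMat_sndMat, lastVec_eq] at hr
        exact ⟨hrow, (hw _ hk).mp hr⟩
      · rintro ⟨hrow, hmem⟩
        obtain ⟨hX, hY⟩ := (lastRowZero_iff y w).mpr hrow
        refine ⟨⟨⟨hrow, hy.1, hle hmem⟩, hy.2⟩, ?_⟩
        rw [← rank_matA_succ hX hY, subMat_fstMat, subMat_sndMat, lastVec_eq]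
        exact (hw _ (hle hmem)).mpr hmem

theorem motive_rankPiece_eq {n r c : ℕ}
    (h : IsLinearFamily (rankStratum k d n) (reindexMap k (splitIndex d) ⁻¹' rankPiece k d n r) c) :
    (subvariety (rankPiece k d n r)).motive
      = lefschetz k ^ c * (subvariety (rankStratum k d n)).motive := by
  rw [← h.motive_eq, motive_reindexMap_preimage _ (isLocallyClosed_rankPiece n r)]

theorem motive_rankPiece_zero (n : ℕ) : (subvariety (rankPiece k d n 0)).motive
    = lefschetz k ^ n * (subvariety (rankStratum k d n)).motive := by
  refine motive_rankPiece_eq (isLinearFamily_rankPiece n 0 n fun K _ X Y h hn => ?_)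
  subst hn
  exact ⟨imA X Y, imA_le_kerB h, rfl, fun w hw => (finrank_sup_span_pair h hw rfl).1⟩

theorem motive_rankPiece_one (n : ℕ) : (subvariety (rankPiece k d n 1)).motive
    = lefschetz k ^ d * (subvariety (rankStratum k d n)).motive := by
  refine motive_rankPiece_eq (isLinearFamily_rankPiece n 1 d fun K _ X Y h hn => ?_)
  subst hn
  exact ⟨midSubmodule X Y, inf_le_left, finrank_midSubmodule h,
    fun w hw => (finrank_sup_span_pair h hw rfl).2.1⟩

theorem motive_rankPiece_two (n : ℕ) : (subvariety (rankPiece k d n 2)).motive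
    = lefschetz k ^ (2 * d - n) * (subvariety (rankStratum k d n)).motive := by
  refine motive_rankPiece_eq (isLinearFamily_rankPiece n 2 (2 * d - n) fun K _ X Y h hn => ?_)
  subst hn
  refine ⟨kerB X Y, le_rfl, ?_, fun w hw => iff_of_true (finrank_sup_span_pair h hw rfl).2.2 hw⟩
  have := finrank_kerB (X := X) (Y := Y)
  omega

end Family

section Recursion

variable {k : Type u} [Field k] {d : ℕ}

/-- The class of the stratum of rank `n`. -/
noncomputable def motiveRank (k : Type u) [Field k] (d n : ℕ) : KVar k :=
  (subvariety (rankStratum k d n)).motive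

theorem rk_mem_of_stair {x : PairSpace k (d + 1)} (hx : x ∈ stairV k (d + 1)) :
    rkSub x ≤ rk x ∧ rk x ≤ rkSub x + 2 := by
  rw [mem_stairV_iff, isStair_succ_iff] at hx
  obtain ⟨⟨hX, hY⟩, ⟨-, -, h⟩, hk⟩ := hx
  have h1 := rank_matA_succ hX hY
  refine ⟨?_, (finrank_sup_span_pair h hk h1).2.2⟩
  rw [rk, ← h1]
  exact Submodule.finrank_mono (s := imA _ _) le_sup_left

theorem rankPiece_diff (n r : ℕ) :
    (rankPiece k d n (r + 1) \ {x | rk x ≤ n + r}) =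
      rankStratum k (d + 1) (n + (r + 1)) ∩ {x | rkSub x = n} := by
  ext x
  simp only [rankPiece, rankStratum, Set.mem_sdiff, Set.mem_inter_iff, Set.mem_ofPred_eq]
  constructor
  · rintro ⟨⟨⟨h₁, h₂⟩, h₃⟩, h₄⟩
    exact ⟨⟨h₁, by omega⟩, h₂⟩
  · rintro ⟨⟨h₁, h₂⟩, h₃⟩
    exact ⟨⟨⟨h₁, h₃⟩, by omega⟩, by omega⟩

theorem rankPiece_inter (n r : ℕ) :
    (rankPiece k d n (r + 1) ∩ {x | rk x ≤ n + r}) = rankPiece k d n r := by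
  ext x
  simp only [rankPiece, Set.mem_inter_iff, Set.mem_ofPred_eq]
  constructor
  · rintro ⟨⟨h₁, h₂⟩, h₃⟩
    exact ⟨h₁, h₃⟩
  · rintro ⟨h₁, h₂⟩
    exact ⟨⟨h₁, by omega⟩, h₂⟩

theorem rankPiece_zero (n : ℕ) :
    rankPiece k d n 0 = rankStratum k (d + 1) n ∩ {x | rkSub x = n} := by
  ext x
  simp only [rankPiece, rankStratum, Set.mem_inter_iff, Set.mem_ofPred_eq]
  constructor
  · rintro ⟨⟨h₁, h₂⟩, h₃⟩
    have := rk_mem_of_stair h₁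
    exact ⟨⟨h₁, by omega⟩, h₂⟩
  · rintro ⟨⟨h₁, h₂⟩, h₃⟩
    exact ⟨⟨h₁, h₃⟩, by omega⟩

theorem motive_fiber_zero (n : ℕ) :
    (subvariety (rankStratum k (d + 1) n ∩ {x | rkSub x = n})).motive
      = lefschetz k ^ n * motiveRank k d n := by
  rw [← rankPiece_zero, motive_rankPiece_zero, motiveRank]

theorem motive_fiber_succ (n r : ℕ) :
    (subvariety (rankStratum k (d + 1) (n + (r + 1)) ∩ {x | rkSub x = n})).motive
      = (subvariety (rankPiece k d n (r + 1))).motive - (subvariety (rankPiece k d n r)).motive := by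
  rw [motive_subvariety_add (isLocallyClosed_rankPiece n (r + 1)) (isClosed_rk_le (n + r)),
    rankPiece_inter, rankPiece_diff]
  ring

theorem motive_fiber_one (n : ℕ) :
    (subvariety (rankStratum k (d + 1) (n + 1) ∩ {x | rkSub x = n})).motive
      = (lefschetz k ^ d - lefschetz k ^ n) * motiveRank k d n := by
  rw [motive_fiber_succ n 0, motive_rankPiece_one, motive_rankPiece_zero, motiveRank]
  ring

theorem motive_fiber_two (n : ℕ) :
    (subvariety (rankStratum k (d + 1) (n + 2) ∩ {x | rkSub x = n})).motive
      = (lefschetz k ^ (2 * d - n) - lefschetz k ^ d) * motiveRank k d n := by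
  rw [motive_fiber_succ n 1, motive_rankPiece_two, motive_rankPiece_one, motiveRank]
  ring

theorem motiveRank_succ_eq_sum (n : ℕ) : motiveRank k (d + 1) n = ∑ m ∈ Finset.range (n + 1),
    (subvariety (rankStratum k (d + 1) n ∩ {x | rkSub x = m})).motive := by
  refine motive_eq_sum_fibers isClosed_rkSub_le (n + 1) (isLocallyClosed_rankStratum n) ?_
  rintro x ⟨hx, hn⟩
  rw [Set.mem_ofPred_eq] at hn
  have := rk_mem_of_stair hx
  omega

theorem motiveRank_succ_zero : motiveRank k (d + 1) 0 = motiveRank k d 0 := by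
  rw [motiveRank_succ_eq_sum, Finset.sum_range_one, motive_fiber_zero, pow_zero, one_mul]

theorem motiveRank_succ_one : motiveRank k (d + 1) 1 = lefschetz k * motiveRank k d 1
    + (lefschetz k ^ d - 1) * motiveRank k d 0 := by
  rw [motiveRank_succ_eq_sum, Finset.sum_range_succ, Finset.sum_range_one, motive_fiber_zero,
    motive_fiber_one 0, pow_zero, pow_one, add_comm]

theorem motiveRank_succ (n : ℕ) : motiveRank k (d + 1) (n + 2) =
    lefschetz k ^ (n + 2) * motiveRank k d (n + 2)
      + (lefschetz k ^ d - lefschetz k ^ (n + 1)) * motiveRank k d (n + 1)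
      + (lefschetz k ^ (2 * d - n) - lefschetz k ^ d) * motiveRank k d n := by
  rw [motiveRank_succ_eq_sum, Finset.sum_range_succ, Finset.sum_range_succ, Finset.sum_range_succ,
    motive_fiber_zero, motive_fiber_one (n + 1), motive_fiber_two, Finset.sum_eq_zero]
  · ring
  · intro m hm
    have he : rankStratum k (d + 1) (n + 2) ∩ {x | rkSub x = m} = ∅ := by
      rw [Set.eq_empty_iff_forall_notMem]
      rintro x ⟨⟨hx, hn⟩, hm'⟩
      rw [Set.mem_ofPred_eq] at hn hm'
      have := rk_mem_of_stair hx
      have := Finset.mem_range.mp hm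
      omega
    rw [he, motive_subvariety_empty]

theorem rk_le_of_stair {x : PairSpace k d} (hx : x ∈ stairV k d) : rk x ≤ d := by
  have hc : CuspEquations (fstMat (coords x)) (sndMat (coords x)) := hx.2.2
  have h := Matrix.rank_add_rank_le_card_of_mul_eq_zero (matB_mul_matA hc)
  rw [rank_matB, Fintype.card_sum, Fintype.card_fin] at h
  rw [rk]
  omega

theorem motiveRank_eq_zero {n : ℕ} (h : d < n) : motiveRank k d n = 0 := by
  have he : rankStratum k d n = ∅ := by
    rw [Set.eq_empty_iff_forall_notMem]
    rintro x ⟨hx, hn⟩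
    rw [Set.mem_ofPred_eq] at hn
    have := rk_le_of_stair hx
    omega
  rw [motiveRank, he, motive_subvariety_empty]

theorem motiveV_eq_sum (k : Type u) [Field k] (d : ℕ) :
    motiveV k d = ∑ n ∈ Finset.range (d + 1), motiveRank k d n :=
  motive_eq_sum_fibers isClosed_rk_le (d + 1) isClosed_stairV.isLocallyClosed
    fun _ hx => Nat.lt_succ_of_le (rk_le_of_stair hx)

theorem motive_univ (k : Type u) [Field k] (σ : Type) [Finite σ] :
    (subvariety (Set.univ : Set (affSpace k σ))).motive = motiveSpec k (MvPolynomial σ k) := by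
  refine motive_subvariety_eq_motiveSpec (AlgHom.id k _) 1 (by simp) (fun b => ⟨b, 0, by simp⟩) ?_
  exact Set.range_eq_univ.mpr fun x => ⟨x, rfl⟩

theorem motiveRank_zero_zero (k : Type u) [Field k] : motiveRank k 0 0 = 1 := by
  have he : rankStratum k 0 0 = Set.univ := by
    rw [Set.eq_univ_iff_forall]
    intro x
    have hx : x ∈ stairV k 0 := by
      refine ⟨fun i => i.elim0, fun i => i.elim0, ?_, ?_⟩ <;> exact Subsingleton.elim _ _
    exact ⟨hx, Nat.le_zero.mp (rk_le_of_stair hx)⟩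
  rw [motiveRank, he, motive_univ, motiveSpec_congr k (MvPolynomial.isEmptyAlgEquiv k (PairIndex 0)),
    motiveSpec_self]

theorem stratumIn_eq (k : Type u) [Field k] (d : ℕ) (a b : ℤ) : stratumIn k d a b =
    {x | a + b = 2 * d ∧ x ∈ stairV k d ∧ (rk x : ℤ) = b} := by
  ext x
  let A := matA (fstMat (coords x)) (sndMat (coords x))
  have h := LinearMap.finrank_range_add_finrank_ker A.mulVecLin
  rw [Module.finrank_fintype_fun_eq_card, Fintype.card_sum, Fintype.card_fin] at h
  change (x ∈ stairV k d ∧ (Module.finrank (resField x) (LinearMap.ker A.mulVecLin) : ℤ) = a ∧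
    (Module.finrank (resField x) (LinearMap.range A.mulVecLin) : ℤ) = b) ↔
    a + b = 2 * d ∧ x ∈ stairV k d ∧ (Module.finrank (resField x) (LinearMap.range A.mulVecLin) : ℤ) = b
  constructor
  · rintro ⟨h₁, h₂, h₃⟩
    exact ⟨by omega, h₁, h₃⟩
  · rintro ⟨h₁, h₂, h₃⟩
    exact ⟨h₂, by omega, h₃⟩

theorem stratumIn_natCast (k : Type u) [Field k] (d n : ℕ) :
    stratumIn k d (2 * (d : ℤ) - n) n = rankStratum k d n := by
  rw [stratumIn_eq]
  ext x
  simp only [rankStratum, Set.mem_inter_iff, Set.mem_ofPred_eq, Nat.cast_inj]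
  exact ⟨fun h => h.2, fun h => ⟨by ring, h⟩⟩

theorem isLocallyClosed_stratumIn (k : Type u) [Field k] (d : ℕ) (a b : ℤ) :
    IsLocallyClosed (stratumIn k d a b) := by
  by_cases h : a + b = 2 * d ∧ 0 ≤ b
  · obtain ⟨n, rfl⟩ := Int.eq_ofNat_of_zero_le h.2
    obtain rfl : a = 2 * (d : ℤ) - n := by omega
    rw [stratumIn_natCast]
    exact isLocallyClosed_rankStratum n
  · have he : stratumIn k d a b = ∅ := by
      rw [stratumIn_eq, Set.eq_empty_iff_forall_notMem]
      rintro x ⟨h₁, -, h₂⟩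
      omega
    rw [he]
    exact isClosed_empty.isLocallyClosed

theorem motiveStratum_natCast (k : Type u) [Field k] (d n : ℕ) :
    motiveStratum k (2 * (d : ℤ) - n) n = motiveRank k d n := by
  have h : ((2 * (d : ℤ) - n + n) / 2).toNat = d := by omega
  have key : ∀ e : ℕ, e = d →
      (subvariety (stratumIn k e (2 * (d : ℤ) - n) n)).motive = motiveRank k d n := by
    rintro _ rfl
    rw [stratumIn_natCast, motiveRank]
  exact key _ h

theorem motiveStratum_eq_zero (k : Type u) [Field k] {a b : ℤ}
    (h : ¬ (b ≤ a ∧ 0 ≤ b ∧ a ≡ b [ZMOD 2])) : motiveStratum k a b = 0 := by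
  have he : stratumIn k ((a + b) / 2).toNat a b = ∅ := by
    rw [stratumIn_eq, Set.eq_empty_iff_forall_notMem]
    rintro x ⟨h₁, hx, h₂⟩
    have := rk_le_of_stair hx
    refine h ⟨by omega, by omega, ?_⟩
    rw [Int.ModEq]
    omega
  rw [motiveStratum, he, motive_subvariety_empty]

end Recursion

/-! ### The recursion in terms of natural numbers -/

/-- The recursion for the strata, indexed by the size of the matrices and the rank. -/
structure RankRecursion {R : Type*} [CommRing R] (L : R) (w : ℕ → ℕ → R) : Prop where
  zero_zero : w 0 0 = 1
  eq_zero : ∀ d n, d < n → w d n = 0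
  succ_zero : ∀ d, w (d + 1) 0 = w d 0
  succ_one : ∀ d, w (d + 1) 1 = L * w d 1 + (L ^ d - 1) * w d 0
  succ_add_two : ∀ d n, w (d + 1) (n + 2) = L ^ (n + 2) * w d (n + 2)
    + (L ^ d - L ^ (n + 1)) * w d (n + 1) + (L ^ (2 * d - n) - L ^ d) * w d n

theorem rankRecursion_motiveRank (k : Type u) [Field k] :
    RankRecursion (lefschetz k) (motiveRank k) where
  zero_zero := motiveRank_zero_zero k
  eq_zero _ _ h := motiveRank_eq_zero h
  succ_zero _ := motiveRank_succ_zero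
  succ_one _ := motiveRank_succ_one
  succ_add_two _ n := motiveRank_succ n

theorem RankRecursion.staircaseRecursion {R : Type*} [CommRing R] {L : R} {w : ℕ → ℕ → R}
    (hw : RankRecursion L w) {v : ℤ → ℤ → R} (h : ∀ d n : ℕ, v (2 * (d : ℤ) - n) n = w d n)
    (h0 : ∀ a b : ℤ, ¬ (b ≤ a ∧ 0 ≤ b ∧ a ≡ b [ZMOD 2]) → v a b = 0) :
    StaircaseRecursion L v := by
  refine ⟨?_, h0, fun a b hba hb hab hne => ?_⟩
  · have := h 0 0
    simpa [hw.zero_zero] using this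
  obtain ⟨n, rfl⟩ := Int.eq_ofNat_of_zero_le hb
  rw [Int.ModEq] at hab
  have hne' : a ≠ 0 ∨ n ≠ 0 := by
    by_contra hc
    push Not at hc
    exact hne (by rw [hc.1, hc.2]; rfl)
  obtain ⟨d, rfl⟩ : ∃ d : ℕ, a = 2 * ((d + 1 : ℕ) : ℤ) - n :=
    ⟨((a + n) / 2 - 1).toNat, by omega⟩
  have e1 : v (2 * ((d + 1 : ℕ) : ℤ) - n - 2) n = w d n := by
    rw [← h]
    congr 1
    push_cast
    ring
  have e2 : ((2 * ((d + 1 : ℕ) : ℤ) - n + n - 2) / 2).toNat = d := by omega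
  have e3 : ((n : ℤ)).toNat = n := by omega
  rw [h, e1, e2, e3]
  match n with
  | 0 =>
    rw [h0 (2 * ((d + 1 : ℕ) : ℤ) - (0 : ℕ) - 1) _ (by omega), h0 _ ((0 : ℕ) - 2 : ℤ) (by omega),
      hw.succ_zero]
    ring
  | 1 =>
    have e4 : v (2 * ((d + 1 : ℕ) : ℤ) - (1 : ℕ) - 1) ((1 : ℕ) - 1) = w d 0 := by
      rw [← h]
      congr 1
      push_cast
      ring
    have e5 : (((1 : ℕ) : ℤ) - 1).toNat = 0 := rfl
    rw [e4, e5, h0 _ ((1 : ℕ) - 2 : ℤ) (by omega), hw.succ_one]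
    ring
  | m + 2 =>
    have e4 : v (2 * ((d + 1 : ℕ) : ℤ) - (m + 2 : ℕ) - 1) ((m + 2 : ℕ) - 1) = w d (m + 1) := by
      rw [← h]
      congr 1 <;> push_cast <;> ring
    have e5 : (((m + 2 : ℕ) : ℤ) - 1).toNat = m + 1 := by omega
    have e6 : v (2 * ((d + 1 : ℕ) : ℤ) - (m + 2 : ℕ)) ((m + 2 : ℕ) - 2) = w d m := by
      rw [← h]
      congr 1 <;> push_cast <;> ring
    have e7 : (2 * ((d + 1 : ℕ) : ℤ) - (m + 2 : ℕ)).toNat = 2 * d - m := by omega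
    rw [e4, e5, e6, e7, hw.succ_add_two]

theorem staircaseRecursion_motiveStratum (k : Type u) [Field k] :
    StaircaseRecursion (lefschetz k) (motiveStratum k) :=
  (rankRecursion_motiveRank k).staircaseRecursion (motiveStratum_natCast k)
    fun _ _ => motiveStratum_eq_zero k

/-- The polynomials computing the classes of the strata. -/
noncomputable def rankPoly : ℕ → ℕ → ℤ[X]
  | 0, 0 => 1
  | 0, _ + 1 => 0
  | d + 1, 0 => rankPoly d 0
  | d + 1, 1 => X * rankPoly d 1 + (X ^ d - 1) * rankPoly d 0
  | d + 1, n + 2 => X ^ (n + 2) * rankPoly d (n + 2) + (X ^ d - X ^ (n + 1)) * rankPoly d (n + 1)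
      + (X ^ (2 * d - n) - X ^ d) * rankPoly d n

theorem rankPoly_eq_zero (d n : ℕ) (h : d < n) : rankPoly d n = 0 := by
  induction d generalizing n with
  | zero =>
    obtain ⟨n, rfl⟩ := Nat.exists_eq_succ_of_ne_zero h.ne'
    rw [Nat.succ_eq_add_one, rankPoly]
  | succ d ih =>
    obtain ⟨n, rfl⟩ := Nat.exists_eq_add_of_le' (show 2 ≤ n by omega)
    rw [rankPoly, ih (n + 2) (by omega), ih (n + 1) (by omega)]
    rcases (show d ≤ n by omega).eq_or_lt with rfl | hlt
    · rw [show 2 * d - d = d by omega]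
      ring
    · rw [ih n hlt]
      ring

theorem rankRecursion_rankPoly : RankRecursion (X : ℤ[X]) rankPoly where
  zero_zero := by rw [rankPoly]
  eq_zero := rankPoly_eq_zero
  succ_zero _ := by rw [rankPoly]
  succ_one _ := by rw [rankPoly]
  succ_add_two _ _ := by rw [rankPoly]

theorem RankRecursion.eq_aeval {R : Type*} [CommRing R] [Algebra ℤ R] {L : R} {w : ℕ → ℕ → R}
    (hw : RankRecursion L w) (d n : ℕ) : w d n = aeval L (rankPoly d n) := by
  induction d generalizing n with
  | zero =>
    cases n with
    | zero => rw [hw.zero_zero, rankPoly, map_one]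
    | succ n => rw [hw.eq_zero _ _ (Nat.succ_pos n), rankPoly, map_zero]
  | succ d ih =>
    match n with
    | 0 => rw [hw.succ_zero, ih, rankPoly]
    | 1 => rw [hw.succ_one, ih, ih, rankPoly]; simp
    | n + 2 => rw [hw.succ_add_two, ih, ih, ih, rankPoly]; simp

/-- The polynomials `rankPoly`, indexed by the dimensions of kernel and image. -/
noncomputable def stairPoly (a b : ℤ) : ℤ[X] :=
  open scoped Classical in
  if b ≤ a ∧ 0 ≤ b ∧ a ≡ b [ZMOD 2] then rankPoly ((a + b) / 2).toNat b.toNat else 0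

theorem stairPoly_eq_zero {a b : ℤ} (h : ¬ (b ≤ a ∧ 0 ≤ b ∧ a ≡ b [ZMOD 2])) :
    stairPoly a b = 0 :=
  if_neg h

theorem stairPoly_natCast (d n : ℕ) : stairPoly (2 * (d : ℤ) - n) n = rankPoly d n := by
  by_cases h : n ≤ d
  · rw [stairPoly, if_pos ⟨by omega, by omega, by rw [Int.ModEq]; omega⟩]
    congr 1
    omega
  · rw [stairPoly_eq_zero (by omega), rankPoly_eq_zero d n (by omega)]

theorem staircaseRecursion_stairPoly : StaircaseRecursion (X : ℤ[X]) stairPoly :=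
  rankRecursion_rankPoly.staircaseRecursion stairPoly_natCast fun _ _ => stairPoly_eq_zero

theorem motiveStratum_eq_aeval (k : Type u) [Field k] (a b : ℤ) :
    motiveStratum k a b = aeval (lefschetz k) (stairPoly a b) := by
  by_cases h : b ≤ a ∧ 0 ≤ b ∧ a ≡ b [ZMOD 2]
  · obtain ⟨h₁, h₂, h₃⟩ := h
    obtain ⟨n, rfl⟩ := Int.eq_ofNat_of_zero_le h₂
    rw [Int.ModEq] at h₃
    obtain ⟨d, rfl⟩ : ∃ d : ℕ, a = 2 * (d : ℤ) - n := ⟨((a + n) / 2).toNat, by omega⟩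
    rw [motiveStratum_natCast, stairPoly_natCast, (rankRecursion_motiveRank k).eq_aeval]
  · rw [motiveStratum_eq_zero k h, stairPoly_eq_zero h, map_zero]

theorem motiveV_eq_sum_motiveStratum (k : Type u) [Field k] (d : ℕ) :
    motiveV k d = ∑ b ∈ Finset.range (d + 1), motiveStratum k (2 * (d : ℤ) - b) b := by
  rw [motiveV_eq_sum]
  exact Finset.sum_congr rfl fun n _ => (motiveStratum_natCast k d n).symm

theorem motiveV_eq_aeval (k : Type u) [Field k] (d : ℕ) : motiveV k d = aeval (lefschetz k)
    (∑ b ∈ Finset.range (d + 1), stairPoly (2 * (d : ℤ) - b) b) := by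
  rw [motiveV_eq_sum_motiveStratum, map_sum]
  exact Finset.sum_congr rfl fun n _ => motiveStratum_eq_aeval k _ _

section Datum

open Matrix

variable {d : ℕ} {α : LeadingDatum d}

theorem MonIdeal.mu0_eq_of_isK {I : MonIdeal} (h : I.IsK) : I.mu0 = I.level + 2 := by
  cases I with
  | J a => exact h.elim
  | K a => rfl

theorem LeadingDatum.level_le_of_stable (hK : α.PureK) (hs : ∀ j, α.Stable j) {b h : Fin d}
    (hbh : b < h) : (α (α.seat b)).level + 3 < (α (α.seat h)).level ∨
      ((α (α.seat b)).level + 3 = (α (α.seat h)).level ∧ α.seat b ≤ α.seat h) := by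
  have hd : (0 : ℚ) < d := by exact_mod_cast Nat.lt_of_le_of_lt (Nat.zero_le _) b.isLt
  have h3 := (hs h b h hbh le_rfl).2 (hK _) (hK _)
  rw [LeadingDatum.dist, Int.le_floor] at h3
  push_cast at h3
  have h1 : ((α.seat h : ℕ) : ℚ) / d < 1 := by
    rw [div_lt_one hd]
    exact_mod_cast (α.seat h).isLt
  have h0 : (0 : ℚ) ≤ ((α.seat b : ℕ) : ℚ) / d := by positivity
  rcases lt_trichotomy ((α (α.seat b)).level + 3) (α (α.seat h)).level with hlt | heq | hgt
  · exact .inl hlt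
  · refine .inr ⟨heq, ?_⟩
    have heq' : (((α (α.seat b)).level : ℚ)) + 3 = (α (α.seat h)).level := by exact_mod_cast heq
    have h2 : ((α.seat b : ℕ) : ℚ) / d ≤ ((α.seat h : ℕ) : ℚ) / d := by linarith
    rw [div_le_div_iff_of_pos_right hd] at h2
    exact_mod_cast h2
  · have hgt' : (((α (α.seat h)).level : ℚ)) + 1 ≤ (α (α.seat b)).level + 3 := by
      exact_mod_cast hgt
    linarith

theorem LeadingDatum.mono_lt_iff (hK : α.PureK) (hs : ∀ j, α.Stable j) {c : ℕ} (hc : 0 < c)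
    (hc3 : c ≤ 3) (b h : Fin d) : mono (α (α.seat h)).mu0 (α.seat h) <
      mono ((α (α.seat b)).mu0 + c) (α.seat b) ↔ h ≤ b := by
  constructor
  · intro hlt
    by_contra hbh
    have h3 := α.level_le_of_stable hK hs (not_le.mp hbh)
    rw [Prod.Lex.toLex_lt_toLex, MonIdeal.mu0_eq_of_isK (hK _), MonIdeal.mu0_eq_of_isK (hK _)]
      at hlt
    rcases hlt with hlt | ⟨heq, hlt⟩
    · omega
    · rcases h3 with h3 | ⟨-, h3⟩
      · omega
      · exact absurd hlt (not_lt.mpr h3)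
  · intro hhb
    have h1 : mono (α (α.seat h)).mu0 (α.seat h) ≤ mono (α (α.seat b)).mu0 (α.seat b) :=
      Tuple.monotone_sort (fun i => mono (α i).mu0 i) hhb
    refine h1.trans_lt ?_
    rw [Prod.Lex.toLex_lt_toLex]
    exact .inl (Nat.lt_add_of_pos_right hc)

variable {k : Type u} [Field k]

theorem isClosed_datumV (α : LeadingDatum d) : IsClosed (datumV k α) :=
  isClosed_cuspEquations.inter ((isClosed_fstMat_eq_zero _).inter (isClosed_sndMat_eq_zero _))

/-- The action of a permutation of rows and columns on the coordinates of pairs of matrices. -/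
def permIndex (s : Equiv.Perm (Fin d)) : PairIndex d ≃ PairIndex d :=
  Equiv.sumCongr (Equiv.prodCongr s s) (Equiv.prodCongr s s)

theorem cuspEquations_submatrix {K : Type u} [Field K] (s : Equiv.Perm (Fin d))
    (X Y : Matrix (Fin d) (Fin d) K) :
    CuspEquations (X.submatrix s s) (Y.submatrix s s) ↔ CuspEquations X Y := by
  let e := Matrix.reindexAlgEquiv K K s.symm
  change e X ^ 2 = e Y ^ 3 ∧ e X * e Y = e Y * e X ↔ _
  rw [← map_pow, ← map_pow, ← map_mul, ← map_mul, e.injective.eq_iff, e.injective.eq_iff]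
  rfl

theorem forall_datum_iff (hK : α.PureK) (hs : ∀ j, α.Stable j) {c : ℕ} (hc : 0 < c) (hc3 : c ≤ 3)
    {K : Type u} [Field K] (M : Matrix (Fin d) (Fin d) K) :
    (∀ i j, mono (α j).mu0 j < mono ((α i).mu0 + c) i → M i j = 0) ↔
      StrictlyUpper (M.submatrix α.seat α.seat) := by
  constructor
  · exact fun h b h' hle => h _ _ ((α.mono_lt_iff hK hs hc hc3 b h').mpr hle)
  · intro h i j hij
    obtain ⟨b, rfl⟩ := α.seat.surjective i
    obtain ⟨b', rfl⟩ := α.seat.surjective j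
    exact h b b' ((α.mono_lt_iff hK hs hc hc3 b b').mp hij)

theorem datumV_eq_preimage (hK : α.PureK) (hs : ∀ j, α.Stable j) :
    datumV k α = reindexMap k (permIndex α.seat) ⁻¹' stairV k d := by
  ext x
  have h : reindexMap k (permIndex α.seat) x = pt (coords x ∘ permIndex α.seat) := by
    rw [← reindexMap_pt, pt_coords]
  have h₁ : fstMat (coords x ∘ permIndex α.seat) =
      (fstMat (coords x)).submatrix α.seat α.seat := rfl
  have h₂ : sndMat (coords x ∘ permIndex α.seat) =
      (sndMat (coords x)).submatrix α.seat α.seat := rfl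
  rw [Set.mem_preimage, h, pt_mem_stairV, h₁, h₂, IsStair, cuspEquations_submatrix,
    ← forall_datum_iff hK hs (show 0 < 3 by norm_num) le_rfl,
    ← forall_datum_iff hK hs (show 0 < 2 by norm_num) (by norm_num)]
  exact and_rotate

theorem motiveDatum_eq (hK : α.PureK) (hs : ∀ j, α.Stable j) :
    motiveDatum k α = motiveV k d := by
  rw [motiveDatum, datumV_eq_preimage hK hs,
    motive_reindexMap_preimage _ isClosed_stairV.isLocallyClosed, motiveV]

end Datum

end CuspStaircase

theorem mainTheorem4 :
    ∃ P : ℤ → ℤ → ℤ[X], CuspStaircase.StaircaseRecursion (X : ℤ[X]) P ∧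
      ∀ (k : Type u) [Field k],
        (∀ d : ℕ, IsClosed (CuspStaircase.stairV k d)) ∧
        (∀ (d : ℕ) (a b : ℤ), IsLocallyClosed (CuspStaircase.stratumIn k d a b)) ∧
        CuspStaircase.StaircaseRecursion (CuspStaircase.lefschetz k)
          (CuspStaircase.motiveStratum k) ∧
        (∀ a b : ℤ, CuspStaircase.motiveStratum k a b
          = aeval (CuspStaircase.lefschetz k) (P a b)) ∧
        (∀ d : ℕ, CuspStaircase.motiveV k d
          = ∑ b ∈ Finset.range (d + 1), CuspStaircase.motiveStratum k (2 * (d : ℤ) - b) b) ∧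
        (∀ d : ℕ, CuspStaircase.motiveV k d
          = aeval (CuspStaircase.lefschetz k)
              (∑ b ∈ Finset.range (d + 1), P (2 * (d : ℤ) - b) b)) ∧
        (∀ (d : ℕ) (α : CuspStaircase.LeadingDatum d), α.PureK → (∀ j : Fin d, α.Stable j) →
          IsClosed (CuspStaircase.datumV k α) ∧
          CuspStaircase.motiveDatum k α
            = aeval (CuspStaircase.lefschetz k)
                (∑ b ∈ Finset.range (d + 1), P (2 * (d : ℤ) - b) b)) := by
  refine ⟨CuspStaircase.stairPoly, CuspStaircase.staircaseRecursion_stairPoly, fun k _ =>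
    ⟨fun d => CuspStaircase.isClosed_stairV, CuspStaircase.isLocallyClosed_stratumIn k,
      CuspStaircase.staircaseRecursion_motiveStratum k, CuspStaircase.motiveStratum_eq_aeval k,
      CuspStaircase.motiveV_eq_sum_motiveStratum k, CuspStaircase.motiveV_eq_aeval k,
      fun d α hK hs => ⟨CuspStaircase.isClosed_datumV α, ?_⟩⟩⟩
  rw [CuspStaircase.motiveDatum_eq hK hs, CuspStaircase.motiveV_eq_aeval]
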